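/- Let $n\ge 1$. For a measurable function $f$ on $\mathbb R^n$ let $M_{HL,b}f(x)=\sup_{B\ni x}\frac1{|B|}\int_B|f|$, where the supremum is over all open Euclidean balls $B\subset\mathbb R^n$ containing $x$ (the uncentered Hardy–Littlewood maximal operator over balls). For $0<\alpha<1$ define the sharp Tauberian constant $$C_{HL,b}(\alpha)=\sup_{E}\frac{1}{|E|}\,\bigl|\{x\in\mathbb R^n: M_{HL,b}\chi_E(x)>\alpha\}\bigr|,$$ the supremum being over all measurable $E\subset\mathbb R^n$ with $0<|E|<\infty$, and define the halo function $\phi_{HL,b}$ on $[0,\infty)$ by $\phi_{HL,b}(x)=x$ for $0\le x\le 1$ and $\phi_{HL,b}(x)=C_{HL,b}(1/x)$ for $x>1$. For an interval $I\subset\mathbb R$ and $0<p\le 1$, write $f\in C^p(I)$ if for every compact $K\subset I$ there is a constant $A_K$ such that $|f(x)-f(y)|\le A_K|x-y|^p$ for all $x,y\in K$. Then $C_{HL,b}$ is finite on $(0,1)$, $\phi_{HL,b}$ is finite on $[0,\infty)$, and $$\phi_{HL,b}\in C^{1/(n+1)}([0,\infty)).$$ Moreover $C_{HL,b}\in C^{1/n}((0,1))$,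 and consequently $\phi_{HL,b}\in C^{1/n}((1,\infty))$. -/

import Mathlib

open MeasureTheory Set
open scoped ENNReal NNReal

/-- The geometric maximal operator `M_B f (x) = sup_{x ∈ R ∈ B} (1 / |R|) ∫_R |f|` of a collection
`B` of subsets of `ℝⁿ`, with values in `[0, ∞]`; it is `0` at points that lie in no member of `B`. -/
noncomputable def maximalOp {n : ℕ} (B : Set (Set (EuclideanSpace ℝ (Fin n))))
    (f : EuclideanSpace ℝ (Fin n) → ℝ) (x : EuclideanSpace ℝ (Fin n)) : ℝ≥0∞ :=
  ⨆ R ∈ {R | R ∈ B ∧ x ∈ R}, (∫⁻ y in R, ‖f y‖ₑ) / volume R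

/-- The halo set `{x : M_B χ_E (x) > α}`. -/
def haloSet {n : ℕ} (B : Set (Set (EuclideanSpace ℝ (Fin n)))) (α : ℝ)
    (E : Set (EuclideanSpace ℝ (Fin n))) : Set (EuclideanSpace ℝ (Fin n)) :=
  {x | ENNReal.ofReal α < maximalOp B (E.indicator fun _ => (1 : ℝ)) x}

/-- The sharp Tauberian constant
`C_B(α) = sup {|{x : M_B χ_E (x) > α}| / |E| : E measurable, 0 < |E| < ∞}` in `[0, ∞]`. -/
noncomputable def tauberianConst {n : ℕ} (B : Set (Set (EuclideanSpace ℝ (Fin n))))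
    (α : ℝ) : ℝ≥0∞ :=
  ⨆ E ∈ {E : Set (EuclideanSpace ℝ (Fin n)) |
      MeasurableSet E ∧ 0 < volume E ∧ volume E < ∞},
    volume (haloSet B α E) / volume E

/-- The halo function, on `[0, ∞)`: `φ_B(x) = x` for `x ≤ 1`, and
`φ_B(x) = sup {|{M_B χ_E > 1 / x}| / |E| : E measurable, 0 < |E| < ∞}` for `x > 1`. -/
noncomputable def haloFun {n : ℕ} (B : Set (Set (EuclideanSpace ℝ (Fin n))))
    (x : ℝ) : ℝ≥0∞ :=
  if x ≤ 1 then ENNReal.ofReal x else tauberianConst B (1 / x)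

/-- The collection of all (open) Euclidean balls of `ℝⁿ`. -/
def ballBasis (n : ℕ) : Set (Set (EuclideanSpace ℝ (Fin n))) :=
  {R | ∃ (c : EuclideanSpace ℝ (Fin n)) (r : ℝ), 0 < r ∧ R = Metric.ball c r}

/-- The (local) Hölder class `C^p(I)`: for every compact `K ⊆ I` there is a constant `A` with
`|f x - f y| ≤ A |x - y| ^ p` for all `x, y ∈ K`. -/
def LocHolderClass (p : ℝ≥0) (I : Set ℝ) (f : ℝ → ℝ) : Prop :=
  ∀ K : Set ℝ, K ⊆ I → IsCompact K → ∃ A : ℝ≥0, HolderOnWith A p f K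

/-! The engine is a Solyanik estimate. For `lam` close to 1, a set `E` is enlarged to `E'` with
`|E'| ≤ lam⁻ᴺ |E|`, a loss of order `1 - lam`, such that `E'` swallows every ball in which `E`
misses a proportion below `s = c (1 - lam) ^ n` (`exists_enlargement`). The set `E'` is built by
adjoining, direction after direction, one-sided maximal halos along segments; the one-sided maximal
inequality has constant exactly `1 / lam`, by the maximal ergodic inequality for translations. A
point that escapes the halos of the `n` vectors of a frame is the vertex of a box of which `E`
misses a proportion `(1 - lam) ^ n`, and finitely many frames fit such a box, of comparable size,
into any ball at any of its points.

In a ball that is not swallowed, a Vitali argument shows that passing from `E` to `E'` multiplies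
the density by at least `1 + s d`, where `d` depends only on `n` (`volume_inter_ball_gain`). Hence
`lam ^ N * C(α) ≤ C(α (1 + s d))`, and `lam ^ N * C(α) ≤ 1` once `α ≥ 1 - s`
(`exists_tauberianConst_le`). Iteration gives finiteness. Solving `α (1 + s d) = β` for `lam` makes
`1 - lam` comparable to `(β - α) ^ (1 / n)`, which is the Hölder bound. The second inequality gives
the same exponent at `α = 1`, where the two formulas for the halo function meet; so exponent `1 / n`
holds on all of `[0, ∞)`, and `1 / (n + 1)` follows. -/

/-! ### The maximal ergodic inequality. -/

/-- The iteration `M₀ = 0`, `M_{k+1} = (f + M_k ∘ T) - c` (truncated), whose value at `x` is the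
maximal excess over `c` of the partial orbit sums of `f`. -/
noncomputable def orbitExcess {X : Type*} (T : X → X) (f : X → ℝ≥0∞) (c : ℝ≥0∞) :
    ℕ → X → ℝ≥0∞
  | 0 => fun _ => 0
  | k + 1 => fun x => f x + orbitExcess T f c k (T x) - c

section Ergodic

variable {X : Type*} {T : X → X} {f : X → ℝ≥0∞} {c : ℝ≥0∞}

theorem orbitExcess_le_succ (k : ℕ) (x : X) :
    orbitExcess T f c k x ≤ orbitExcess T f c (k + 1) x := by
  induction k generalizing x with
  | zero => exact zero_le
  | succ k ih => exact tsub_le_tsub_right (add_le_add_right (ih (T x)) _) _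

theorem sum_orbit_le (k : ℕ) (x : X) :
    ∑ j ∈ Finset.range k, f (T^[j] x) ≤ k * c + orbitExcess T f c k x := by
  induction k generalizing x with
  | zero => simp
  | succ k ih =>
    rw [Finset.sum_range_succ']
    have h1 := ih (T x)
    have h2 : f x + orbitExcess T f c k (T x) ≤ c + orbitExcess T f c (k + 1) x := le_add_tsub
    calc ∑ j ∈ Finset.range k, f (T^[j + 1] x) + f (T^[0] x)
        ≤ (k * c + orbitExcess T f c k (T x)) + f x := by
          gcongr
          · exact h1
          · exact le_rfl
      _ = k * c + (f x + orbitExcess T f c k (T x)) := by ring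
      _ ≤ k * c + (c + orbitExcess T f c (k + 1) x) := by gcongr
      _ = (k + 1 : ℕ) * c + orbitExcess T f c (k + 1) x := by push_cast; ring

variable [MeasurableSpace X] {μ : Measure X}

theorem measurable_orbitExcess (hT : Measurable T) (hf : Measurable f) (k : ℕ) :
    Measurable (orbitExcess T f c k) := by
  induction k with
  | zero => exact measurable_const
  | succ k ih => exact (hf.add (ih.comp hT)).sub measurable_const

/-- Needed only for finiteness, so that the integral of the excess can be cancelled in the next
proof. -/
theorem lintegral_orbitExcess_le (hT : MeasurePreserving T μ μ) (hf : Measurable f) (k : ℕ) :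
    ∫⁻ x, orbitExcess T f c k x ∂μ ≤ k * ∫⁻ x, f x ∂μ := by
  induction k with
  | zero => simp [orbitExcess]
  | succ k ih =>
    calc ∫⁻ x, orbitExcess T f c (k + 1) x ∂μ
        ≤ ∫⁻ x, f x + orbitExcess T f c k (T x) ∂μ := lintegral_mono fun x => tsub_le_self
      _ = ∫⁻ x, f x ∂μ + ∫⁻ x, orbitExcess T f c k x ∂μ := by
          rw [lintegral_add_left hf, hT.lintegral_comp (measurable_orbitExcess hT.measurable hf k)]
      _ ≤ ∫⁻ x, f x ∂μ + k * ∫⁻ x, f x ∂μ := by gcongr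
      _ = (k + 1 : ℕ) * ∫⁻ x, f x ∂μ := by push_cast; ring

/-- Garsia's argument: `M_k + c ≤ f + M_k ∘ T` where `M_k > 0`, and `M_k = 0` elsewhere.
Integrating, the two integrals of `M_k` agree by invariance and cancel. -/
theorem measure_orbitExcess_pos_le (hT : MeasurePreserving T μ μ) (hf : Measurable f)
    (hfin : ∫⁻ x, f x ∂μ ≠ ∞) (k : ℕ) :
    c * μ {x | 0 < orbitExcess T f c k x} ≤ ∫⁻ x, f x ∂μ := by
  have hm := fun k => measurable_orbitExcess (c := c) hT.measurable hf k
  have hA : MeasurableSet {x | 0 < orbitExcess T f c k x} :=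
    measurableSet_lt measurable_const (hm k)
  have hkey : ∫⁻ x, orbitExcess T f c k x ∂μ + c * μ {x | 0 < orbitExcess T f c k x} ≤
      ∫⁻ x, orbitExcess T f c k x ∂μ + ∫⁻ x, f x ∂μ := by
    rw [← lintegral_indicator_const hA, ← lintegral_add_left (hm k), add_comm (∫⁻ _, _ ∂μ),
      ← hT.lintegral_comp (hm k), ← lintegral_add_left hf]
    refine lintegral_mono fun x => ?_
    by_cases hx : 0 < orbitExcess T f c k x
    · rw [indicator_of_mem (by exact hx)]
      cases k with
      | zero => simp [orbitExcess] at hx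
      | succ k =>
        have : c ≤ f x + orbitExcess T f c k (T x) := (tsub_pos_iff_lt.1 hx).le
        calc orbitExcess T f c (k + 1) x + c = f x + orbitExcess T f c k (T x) :=
              tsub_add_cancel_of_le this
          _ ≤ _ := by gcongr; exact orbitExcess_le_succ k (T x)
    · rw [indicator_of_notMem (by exact hx), not_lt.1 hx |> nonpos_iff_eq_zero.1]
      simp
  exact (ENNReal.add_le_add_iff_left
    (ne_top_of_le_ne_top (ENNReal.mul_ne_top (by simp) hfin)
      (lintegral_orbitExcess_le hT hf k))).1 hkey

/-- The maximal ergodic inequality on a measure space of arbitrary mass. -/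
theorem mul_measure_exists_lt_sum_orbit_le (hT : MeasurePreserving T μ μ) (hf : Measurable f)
    (hfin : ∫⁻ x, f x ∂μ ≠ ∞) :
    c * μ {x | ∃ k : ℕ, k * c < ∑ j ∈ Finset.range k, f (T^[j] x)} ≤ ∫⁻ x, f x ∂μ := by
  have hsub : {x | ∃ k : ℕ, k * c < ∑ j ∈ Finset.range k, f (T^[j] x)} ⊆
      ⋃ k, {x | 0 < orbitExcess T f c k x} := by
    rintro x ⟨k, hk⟩
    refine mem_iUnion.2 ⟨k, ?_⟩
    by_contra h
    have h0 : orbitExcess T f c k x = 0 := nonpos_iff_eq_zero.1 (not_lt.1 h)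
    have := hk.trans_le (sum_orbit_le (c := c) k x)
    simp [h0] at this
  have hmono : Monotone fun k => {x | 0 < orbitExcess T f c k x} :=
    monotone_nat_of_le_succ fun k x hx => lt_of_lt_of_le hx (orbitExcess_le_succ k x)
  calc _ ≤ c * μ (⋃ k, {x | 0 < orbitExcess T f c k x}) := by gcongr
    _ = ⨆ k, c * μ {x | 0 < orbitExcess T f c k x} := by
      rw [hmono.measure_iUnion, ENNReal.mul_iSup]
    _ ≤ _ := iSup_le fun k => measure_orbitExcess_pos_le hT hf hfin k

end Ergodic

/-! ### One-sided maximal halos along a direction. -/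

/-- The length of the part of the segment from `x` to `x + ρ v`, parametrised by `(0, ρ]`, that
lies in `E`. -/
noncomputable def segMass {n : ℕ} (v : EuclideanSpace ℝ (Fin n)) (ρ : ℝ)
    (E : Set (EuclideanSpace ℝ (Fin n))) (x : EuclideanSpace ℝ (Fin n)) : ℝ≥0∞ :=
  ∫⁻ s in Ioc 0 ρ, E.indicator 1 (x + s • v)

/-- The halo of `E` for forward averages along `v` over segments of dyadic rational length. -/
def dirHalo {n : ℕ} (v : EuclideanSpace ℝ (Fin n)) (lam : ℝ)
    (E : Set (EuclideanSpace ℝ (Fin n))) : Set (EuclideanSpace ℝ (Fin n)) :=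
  {x | ∃ m k : ℕ, ENNReal.ofReal (lam * (k / 2 ^ m)) < segMass v (k / 2 ^ m) E x}

section DirHalo

variable {n : ℕ} {v : EuclideanSpace ℝ (Fin n)} {ρ lam : ℝ} {E F : Set (EuclideanSpace ℝ (Fin n))}

theorem measurable_indicator_segment (hE : MeasurableSet E) :
    Measurable fun p : EuclideanSpace ℝ (Fin n) × ℝ =>
      E.indicator (1 : EuclideanSpace ℝ (Fin n) → ℝ≥0∞) (p.1 + p.2 • v) :=
  (measurable_one.indicator hE).comp (by fun_prop)

theorem measurable_segMass (hE : MeasurableSet E) : Measurable (segMass v ρ E) :=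
  (measurable_indicator_segment hE).lintegral_prod_right'

theorem segMass_mono (h : E ⊆ F) (x : EuclideanSpace ℝ (Fin n)) :
    segMass v ρ E x ≤ segMass v ρ F x :=
  lintegral_mono fun _ => indicator_le_indicator_of_subset h (fun _ => zero_le) _

theorem lintegral_segMass (hE : MeasurableSet E) (A : Set (EuclideanSpace ℝ (Fin n))) :
    ∫⁻ x in A, segMass v ρ E x = ∫⁻ s in Ioc 0 ρ, volume ((fun x => x + s • v) ⁻¹' E ∩ A) := by
  unfold segMass
  rw [lintegral_lintegral_swap (measurable_indicator_segment hE).aemeasurable]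
  refine lintegral_congr fun s => ?_
  have hm : MeasurableSet ((fun x => x + s • v) ⁻¹' E) := by
    exact measurable_id.add_const _ hE
  rw [← Measure.restrict_apply hm, ← lintegral_indicator_one hm]
  rfl

theorem lintegral_segMass_univ (hE : MeasurableSet E) :
    ∫⁻ x, segMass v ρ E x = ENNReal.ofReal ρ * volume E := by
  rw [← setLIntegral_univ, lintegral_segMass hE]
  simp [measure_preimage_add_right, mul_comm]

/-- Cutting a segment into pieces of length `h` turns its mass into an orbit sum of the translation
by `h • v`, to which the ergodic inequality applies. -/
theorem segMass_le_sum {h : ℝ} (k : ℕ) (x : EuclideanSpace ℝ (Fin n)) :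
    segMass v (k * h) E x ≤
      ∑ j ∈ Finset.range k, segMass v h E ((fun y => y + h • v)^[j] x) := by
  induction k with
  | zero => simp [segMass]
  | succ k ih =>
    rw [Finset.sum_range_succ]
    have hsplit : Ioc 0 (((k + 1 : ℕ) : ℝ) * h) ⊆ Ioc 0 (k * h) ∪ Ioc (k * h) (k * h + h) := by
      intro s hs
      by_cases h' : s ≤ k * h
      · exact Or.inl ⟨hs.1, h'⟩
      · refine Or.inr ⟨not_le.1 h', hs.2.trans (le_of_eq (by push_cast; ring))⟩
    have hiter : ∀ j : ℕ, (fun y : EuclideanSpace ℝ (Fin n) => y + h • v)^[j] x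
        = x + (j * h) • v := by
      intro j
      induction j with
      | zero => simp
      | succ j ihj =>
        rw [Function.iterate_succ_apply', ihj]
        push_cast
        module
    calc segMass v (((k + 1 : ℕ) : ℝ) * h) E x
        ≤ ∫⁻ s in Ioc 0 (k * h) ∪ Ioc (k * h) (k * h + h), E.indicator 1 (x + s • v) :=
          lintegral_mono_set hsplit
      _ ≤ segMass v (k * h) E x + ∫⁻ s in Ioc (k * h) (k * h + h), E.indicator 1 (x + s • v) :=
          lintegral_union_le _ _ _
      _ ≤ _ := by
          refine add_le_add ih (le_of_eq ?_)
          rw [hiter, segMass]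
          have hmp := (measurePreserving_add_right (volume : Measure ℝ) (k * h)).setLIntegral_comp_preimage_emb
            (MeasurableEquiv.addRight (k * h : ℝ)).measurableEmbedding
            (fun s => E.indicator 1 (x + s • v)) (Ioc (k * h) (k * h + h))
          rw [← hmp]
          have : (fun x => x + k * h) ⁻¹' Ioc (k * h) (k * h + h) = Ioc 0 h := by
            ext s; simp [add_comm]
          rw [this]
          refine lintegral_congr fun s => ?_
          congr 1
          module

theorem measurableSet_dirHalo (hE : MeasurableSet E) : MeasurableSet (dirHalo v lam E) := by
  have : dirHalo v lam E = ⋃ m : ℕ, ⋃ k : ℕ,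
      {x | ENNReal.ofReal (lam * (k / 2 ^ m)) < segMass v (k / 2 ^ m) E x} := by
    ext x; simp [dirHalo]
  rw [this]
  exact .iUnion fun m => .iUnion fun k =>
    measurableSet_lt measurable_const (measurable_segMass hE)

/-- The one-sided maximal inequality along `v`. -/
theorem mul_volume_dirHalo_le (hlam : 0 ≤ lam) (hE : MeasurableSet E) (hfin : volume E ≠ ∞) :
    ENNReal.ofReal lam * volume (dirHalo v lam E) ≤ volume E := by
  set A : ℕ → Set (EuclideanSpace ℝ (Fin n)) := fun m =>
    ⋃ k : ℕ, {x | ENNReal.ofReal (lam * (k / 2 ^ m)) < segMass v (k / 2 ^ m) E x} with hA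
  have hunion : dirHalo v lam E = ⋃ m, A m := by
    ext x; simp [dirHalo, hA]
  -- Dyadic meshes are nested, so the halo is an increasing union and a single mesh `2⁻ᵐ` suffices.
  have hmono : Monotone A := by
    refine monotone_nat_of_le_succ fun m x hx => ?_
    obtain ⟨k, hk⟩ := mem_iUnion.1 hx
    refine mem_iUnion.2 ⟨2 * k, ?_⟩
    have : (((2 * k : ℕ) : ℝ) / 2 ^ (m + 1)) = k / 2 ^ m := by
      push_cast; rw [pow_succ]; field_simp
    rw [mem_ofPred_eq, this]
    exact hk
  rw [hunion, hmono.measure_iUnion, ENNReal.mul_iSup]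
  refine iSup_le fun m => ?_
  set h : ℝ := 1 / 2 ^ m with hh
  have hpos : 0 < h := by positivity
  have hint := lintegral_segMass_univ (v := v) (ρ := h) hE
  have key := mul_measure_exists_lt_sum_orbit_le (c := ENNReal.ofReal (lam * h))
    (measurePreserving_add_right (volume : Measure (EuclideanSpace ℝ (Fin n))) (h • v))
    (measurable_segMass (v := v) (ρ := h) hE)
    (by rw [hint]; exact ENNReal.mul_ne_top (by simp) hfin)
  have hsub : A m ⊆ {x | ∃ k : ℕ, k * ENNReal.ofReal (lam * h) <
      ∑ j ∈ Finset.range k, segMass v h E ((fun y => y + h • v)^[j] x)} := by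
    intro x hx
    obtain ⟨k, hk⟩ := mem_iUnion.1 hx
    refine ⟨k, ?_⟩
    have e : (k : ℝ) / 2 ^ m = k * h := by rw [hh]; ring
    rw [mem_ofPred_eq, e] at hk
    refine lt_of_le_of_lt (le_of_eq ?_) (hk.trans_le (segMass_le_sum k x))
    rw [← ENNReal.ofReal_natCast, ← ENNReal.ofReal_mul (by positivity)]
    congr 1; ring
  have h2 : ENNReal.ofReal h * (ENNReal.ofReal lam * volume (A m)) ≤
      ENNReal.ofReal h * volume E := by
    calc _ = ENNReal.ofReal (lam * h) * volume (A m) := by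
          rw [ENNReal.ofReal_mul hlam]; ring
      _ ≤ _ := le_trans (by gcongr) key
      _ = _ := hint
  exact (ENNReal.mul_le_mul_iff_right (by simpa using hpos) (by simp)).1 h2

-- Otherwise take a compact `K` of positive measure in the difference. Translates of `K` by short
-- multiples of `v` almost coincide with `K`, so the mean over `K` of the segment mass is nearly the
-- full length `h`, whereas off the halo it is at most `lam * h`.
open scoped Pointwise in
theorem volume_diff_dirHalo (h0 : 0 ≤ lam) (hlam : lam < 1) (hE : MeasurableSet E) :
    volume (E \ dirHalo v lam E) = 0 := by
  by_contra hne
  obtain ⟨K, hKE, hK, hKpos⟩ := (hE.diff (measurableSet_dirHalo (v := v) (lam := lam) hE)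
    ).exists_lt_isCompact (pos_iff_ne_zero.2 hne)
  have hKfin := hK.measure_ne_top (μ := (volume : Measure (EuclideanSpace ℝ (Fin n))))
  have hlim := tendsto_measure_vadd_sdiff_isCompact_isClosed (G := EuclideanSpace ℝ (Fin n))
    hK hK.isClosed (μ := volume)
  -- Half of the gap `1 - lam`: the final comparison reads `1 ≤ lam + (1 - lam) / 2`, which is
  -- false.
  have hε : 0 < ENNReal.ofReal ((1 - lam) / 2) * volume K :=
    ENNReal.mul_pos (by simpa using hlam) hKpos.ne'
  have hev : ∀ᶠ s : ℝ in nhds 0, volume ((s • v +ᵥ K) \ K) <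
      ENNReal.ofReal ((1 - lam) / 2) * volume K := by
    have hc : Filter.Tendsto (fun s : ℝ => s • v) (nhds 0) (nhds 0) := by
      have : Continuous fun s : ℝ => s • v := by fun_prop
      simpa using this.tendsto 0
    exact (hlim.comp hc).eventually (gt_mem_nhds hε)
  obtain ⟨η, hη, hball⟩ := Metric.eventually_nhds_iff.1 hev
  obtain ⟨m, hm⟩ := exists_pow_lt_of_lt_one hη (show (1 / 2 : ℝ) < 1 by norm_num)
  set h : ℝ := 1 / 2 ^ m with hh
  have hpos : 0 < h := by positivity
  have hhη : h < η := by rw [hh, ← one_div_pow]; exact hm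
  have hlow : ∀ s ∈ Ioc 0 h, volume K ≤ volume ((fun x => x + s • v) ⁻¹' K ∩ K) +
      ENNReal.ofReal ((1 - lam) / 2) * volume K := by
    intro s hs
    have hs' : dist s 0 < η := by
      rw [Real.dist_eq, sub_zero, abs_of_pos hs.1]; exact hs.2.trans_lt hhη
    have e : (fun x => x + s • v) ⁻¹' ((s • v +ᵥ K) \ K) = K \ (fun x => x + s • v) ⁻¹' K := by
      ext x
      simp [mem_vadd_set, add_comm x]
    have h1 : volume (K \ (fun x => x + s • v) ⁻¹' K) ≤
        ENNReal.ofReal ((1 - lam) / 2) * volume K := by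
      rw [← e, measure_preimage_add_right]
      exact (hball hs').le
    calc volume K ≤ volume (K ∩ (fun x => x + s • v) ⁻¹' K) +
          volume (K \ (fun x => x + s • v) ⁻¹' K) := measure_le_inter_add_sdiff _ _ _
      _ ≤ _ := by rw [inter_comm]; gcongr
  have hup : ∀ x ∈ K, segMass v h K x ≤ ENNReal.ofReal (lam * h) := by
    intro x hx
    have hnot := (hKE hx).2
    refine (segMass_mono (hKE.trans sdiff_subset) x).trans (not_lt.1 fun hlt => hnot ⟨m, 1, ?_⟩)
    simpa [hh] using hlt
  have hI : ENNReal.ofReal h * volume K ≤ ENNReal.ofReal (lam * h) * volume K +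
      ENNReal.ofReal h * (ENNReal.ofReal ((1 - lam) / 2) * volume K) := by
    calc ENNReal.ofReal h * volume K = ∫⁻ _ in Ioc 0 h, volume K := by simp [mul_comm]
      _ ≤ ∫⁻ s in Ioc 0 h, (volume ((fun x => x + s • v) ⁻¹' K ∩ K) +
            ENNReal.ofReal ((1 - lam) / 2) * volume K) :=
          setLIntegral_mono' measurableSet_Ioc hlow
      _ = (∫⁻ x in K, segMass v h K x) +
            ENNReal.ofReal h * (ENNReal.ofReal ((1 - lam) / 2) * volume K) := by
          rw [lintegral_add_right _ measurable_const, ← lintegral_segMass hK.measurableSet]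
          simp [mul_comm]
      _ ≤ _ := by
          gcongr
          calc _ ≤ ∫⁻ _ in K, ENNReal.ofReal (lam * h) :=
                setLIntegral_mono' hK.measurableSet hup
            _ = _ := by simp
  have hIr := ENNReal.toReal_mono (by finiteness) hI
  rw [ENNReal.toReal_add (by finiteness) (by finiteness)] at hIr
  simp only [ENNReal.toReal_mul, ENNReal.toReal_ofReal hpos.le,
    ENNReal.toReal_ofReal (show 0 ≤ (1 - lam) / 2 by linarith), ENNReal.toReal_ofReal'] at hIr
  have hk : 0 < (volume K).toReal := ENNReal.toReal_pos hKpos.ne' hKfin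
  have hp : 0 < h * (volume K).toReal := by positivity
  rw [max_eq_left (by positivity)] at hIr
  nlinarith

/-- Adjoining the directional halo multiplies the measure by at most `1 / lam`. -/
theorem mul_volume_union_dirHalo_le (h0 : 0 < lam) (h1 : lam < 1) (hE : MeasurableSet E)
    (hfin : volume E ≠ ∞) :
    ENNReal.ofReal lam * volume (E ∪ dirHalo v lam E) ≤ volume E := by
  have : volume (E ∪ dirHalo v lam E) ≤ volume (dirHalo v lam E) := by
    rw [← sdiff_union_self]
    refine (measure_union_le _ _).trans ?_
    rw [volume_diff_dirHalo h0.le h1 hE, zero_add]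
  exact le_trans (by gcongr) (mul_volume_dirHalo_le h0.le hE hfin)

end DirHalo

/-! ### Iterated halos and parallelepipeds. -/

/-- Successive adjunction of the halos in the directions of a list, the last direction first. -/
def iterHalo {n : ℕ} (L : List (EuclideanSpace ℝ (Fin n))) (lam : ℝ)
    (E : Set (EuclideanSpace ℝ (Fin n))) : Set (EuclideanSpace ℝ (Fin n)) :=
  L.foldr (fun v F => F ∪ dirHalo v lam F) E

section IterHalo

variable {n : ℕ} {lam : ℝ} {E F : Set (EuclideanSpace ℝ (Fin n))}
  {L : List (EuclideanSpace ℝ (Fin n))}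

theorem dirHalo_mono (v : EuclideanSpace ℝ (Fin n)) (h : E ⊆ F) :
    dirHalo v lam E ⊆ dirHalo v lam F := by
  rintro x ⟨m, k, hk⟩
  exact ⟨m, k, hk.trans_le (segMass_mono h x)⟩

theorem iterHalo_mono (h : E ⊆ F) : iterHalo L lam E ⊆ iterHalo L lam F := by
  induction L with
  | nil => exact h
  | cons v L ih => exact union_subset_union ih (dirHalo_mono v ih)

theorem subset_iterHalo : E ⊆ iterHalo L lam E := by
  induction L with
  | nil => exact subset_rfl
  | cons v L ih => exact ih.trans subset_union_left

theorem iterHalo_append (L₁ L₂ : List (EuclideanSpace ℝ (Fin n))) :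
    iterHalo (L₁ ++ L₂) lam E = iterHalo L₁ lam (iterHalo L₂ lam E) :=
  List.foldr_append

theorem measurableSet_iterHalo (hE : MeasurableSet E) : MeasurableSet (iterHalo L lam E) := by
  induction L with
  | nil => exact hE
  | cons v L ih => exact ih.union (measurableSet_dirHalo ih)

/-- Finiteness is carried through the induction because the maximal inequality for the next
direction requires it. -/
theorem volume_iterHalo_le (h0 : 0 < lam) (h1 : lam < 1) (hE : MeasurableSet E)
    (hfin : volume E ≠ ∞) :
    ENNReal.ofReal lam ^ L.length * volume (iterHalo L lam E) ≤ volume E ∧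
      volume (iterHalo L lam E) ≠ ∞ := by
  have hpos : ENNReal.ofReal lam ≠ 0 := by simpa using h0
  induction L with
  | nil => simpa [iterHalo] using hfin
  | cons v L ih =>
    have key := mul_volume_union_dirHalo_le (v := v) h0 h1
      (measurableSet_iterHalo (L := L) (lam := lam) hE) ih.2
    refine ⟨?_, fun htop => ?_⟩
    · rw [List.length_cons, pow_succ, mul_assoc]
      exact le_trans (by gcongr; exact key) ih.1
    · change volume (iterHalo L lam E ∪ dirHalo v lam (iterHalo L lam E)) = ∞ at htop
      rw [htop, ENNReal.mul_top hpos] at key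
      exact ih.2 (top_le_iff.1 key)

/-- This allows one enlargement to serve all frames at once. -/
theorem iterHalo_subset_flatMap {ι : Type*} (g : ι → List (EuclideanSpace ℝ (Fin n)))
    {ls : List ι} {i : ι} (hi : i ∈ ls) : iterHalo (g i) lam E ⊆ iterHalo (ls.flatMap g) lam E := by
  induction ls with
  | nil => simp at hi
  | cons a ls ih =>
    rw [List.flatMap_cons, iterHalo_append]
    rcases List.mem_cons.1 hi with rfl | h
    · exact iterHalo_mono subset_iterHalo
    · exact (ih h).trans subset_iterHalo

theorem le_volume_of_notMem_dirHalo (hlam : 0 ≤ lam) (hE : MeasurableSet E)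
    {v x : EuclideanSpace ℝ (Fin n)} (m k : ℕ) (hx : x ∉ dirHalo v lam E) :
    ENNReal.ofReal ((1 - lam) * (k / 2 ^ m)) ≤
      volume (Ioc (0 : ℝ) (k / 2 ^ m) ∩ {s | x + s • v ∉ E}) := by
  set ρ : ℝ := k / 2 ^ m with hρ
  have hρ0 : 0 ≤ ρ := by positivity
  have hseg : segMass v ρ E x ≤ ENNReal.ofReal (lam * ρ) := not_lt.1 fun h => hx ⟨m, k, h⟩
  have hm : MeasurableSet {s : ℝ | x + s • v ∈ E} :=
    (show Measurable fun s : ℝ => x + s • v by fun_prop) hE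
  have e : segMass v ρ E x = volume (Ioc 0 ρ ∩ {s | x + s • v ∈ E}) := by
    rw [inter_comm, ← Measure.restrict_apply hm, ← lintegral_indicator_one hm]
    rfl
  have hsum : ENNReal.ofReal ρ ≤ volume (Ioc 0 ρ ∩ {s | x + s • v ∈ E}) +
      volume (Ioc 0 ρ ∩ {s | x + s • v ∉ E}) := by
    calc ENNReal.ofReal ρ = volume (Ioc 0 ρ) := by simp
      _ ≤ _ := measure_le_inter_add_sdiff _ _ {s | x + s • v ∈ E}
  have : ENNReal.ofReal (lam * ρ) + ENNReal.ofReal ((1 - lam) * ρ) ≤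
      ENNReal.ofReal (lam * ρ) + volume (Ioc 0 ρ ∩ {s | x + s • v ∉ E}) := by
    rcases le_or_gt lam 1 with h1 | h1
    · rw [← ENNReal.ofReal_add (by positivity) (mul_nonneg (by linarith) hρ0)]
      calc _ = ENNReal.ofReal ρ := by congr 1; ring
        _ ≤ _ := hsum.trans (by gcongr; rw [← e]; exact hseg)
    · rw [ENNReal.ofReal_of_nonpos (p := (1 - lam) * ρ)
        (mul_nonpos_of_nonpos_of_nonneg (by linarith) hρ0), add_zero]
      exact le_self_add
  exact (ENNReal.add_le_add_iff_left (by simp)).1 this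

/-- A point that escapes the iterated halo along `v` is the vertex of a parallelepiped spanned by
`ρ v` in which `E` misses a proportion at least `(1 - lam) ^ d`. -/
theorem le_volume_box_of_notMem_iterHalo (hlam : 0 ≤ lam) (hE : MeasurableSet E) (m k : ℕ)
    {d : ℕ} (v : Fin d → EuclideanSpace ℝ (Fin n)) {x : EuclideanSpace ℝ (Fin n)}
    (hx : x ∉ iterHalo (List.ofFn v) lam E) :
    ENNReal.ofReal ((1 - lam) * (k / 2 ^ m)) ^ d ≤
      volume {s : Fin d → ℝ | (∀ j, s j ∈ Ioc (0 : ℝ) (k / 2 ^ m)) ∧ x + ∑ j, s j • v j ∉ E} := by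
  induction d generalizing x with
  | zero =>
    have : {s : Fin 0 → ℝ | (∀ j, s j ∈ Ioc (0 : ℝ) (k / 2 ^ m)) ∧ x + ∑ j, s j • v j ∉ E}
        = univ := by
      ext s
      simpa [iterHalo] using hx
    rw [this, volume_pi, Measure.pi_univ]
    simp
  | succ d ih =>
    set ρ : ℝ := k / 2 ^ m with hρ
    set S := iterHalo (List.ofFn fun j : Fin d => v j.succ) lam E with hS
    have hSm : MeasurableSet S := measurableSet_iterHalo hE
    rw [List.ofFn_succ] at hx
    have hx' : x ∉ dirHalo (v 0) lam S := fun h => hx (Or.inr h)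
    have h1 := le_volume_of_notMem_dirHalo hlam hSm m k hx'
    rw [← hρ] at h1
    set W := {s : Fin (d + 1) → ℝ | (∀ j, s j ∈ Ioc (0 : ℝ) ρ) ∧ x + ∑ j, s j • v j ∉ E} with hW
    have hWm : MeasurableSet W := by
      have e : W = univ.pi (fun _ => Ioc 0 ρ) ∩
          (fun s : Fin (d + 1) → ℝ => x + ∑ j, s j • v j) ⁻¹' Eᶜ := by
        ext s; simp [hW]
      rw [e]
      exact (MeasurableSet.univ_pi fun _ => measurableSet_Ioc).inter ((show Measurable fun s : Fin (d + 1) → ℝ => x + ∑ j, s j • v j by fun_prop) hE.compl)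
    have hmp := (volume_preserving_piFinSuccAbove (fun _ : Fin (d + 1) => ℝ) 0).symm
    have hvol : volume W = ∫⁻ a : ℝ, volume {s : Fin d → ℝ | Fin.cons a s ∈ W} := by
      rw [← hmp.measure_preimage_equiv, Measure.volume_eq_prod,
        Measure.prod_apply ((MeasurableEquiv.measurable _) hWm)]
      refine lintegral_congr fun a => congrArg _ ?_
      ext s
      simp [MeasurableEquiv.piFinSuccAbove, Fin.insertNthEquiv]
    have hTm : MeasurableSet (Ioc (0 : ℝ) ρ ∩ {s | x + s • v 0 ∉ S}) :=
      measurableSet_Ioc.inter ((show Measurable fun s : ℝ => x + s • v 0 by fun_prop) hSm.compl)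
    rw [hvol, pow_succ]
    -- Fubini in the first coordinate: each `a` with `x + a • v 0 ∉ S` is a new base point for the
    -- remaining directions, and such `a` fill length at least `(1 - lam) * ρ`.
    calc ENNReal.ofReal ((1 - lam) * ρ) ^ d * ENNReal.ofReal ((1 - lam) * ρ)
        ≤ ENNReal.ofReal ((1 - lam) * ρ) ^ d * volume (Ioc (0 : ℝ) ρ ∩ {s | x + s • v 0 ∉ S}) := by
          gcongr
      _ = ∫⁻ _ in Ioc (0 : ℝ) ρ ∩ {s | x + s • v 0 ∉ S}, ENNReal.ofReal ((1 - lam) * ρ) ^ d := by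
          simp
      _ ≤ ∫⁻ a in Ioc (0 : ℝ) ρ ∩ {s | x + s • v 0 ∉ S},
            volume {s : Fin d → ℝ | Fin.cons a s ∈ W} := by
          refine setLIntegral_mono' hTm fun a ha => (ih (fun j => v j.succ) ha.2).trans ?_
          refine measure_mono fun s hs => ⟨fun j => ?_, ?_⟩
          · refine Fin.cases ?_ (fun j => ?_) j
            · simpa using ha.1
            · simpa using hs.1 j
          · rw [Fin.sum_univ_succ]
            simpa [add_assoc] using hs.2
      _ ≤ _ := setLIntegral_le_lintegral _ _

/-- Uniqueness of Haar measure. What matters is that `κ` is finite and depends on the frame alone.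
-/
theorem exists_volume_linear_preimage_eq {v : Fin n → EuclideanSpace ℝ (Fin n)}
    (hv : LinearIndependent ℝ v) :
    ∃ κ : ℝ≥0, ∀ (x : EuclideanSpace ℝ (Fin n)) (S : Set (EuclideanSpace ℝ (Fin n))),
      MeasurableSet S → volume {s : Fin n → ℝ | x + ∑ j, s j • v j ∈ S} = κ * volume S := by
  let b := Module.Basis.mk hv (hv.span_eq_top_of_card_eq_finrank' (by simp)).ge
  let A : (Fin n → ℝ) ≃L[ℝ] EuclideanSpace ℝ (Fin n) := b.equivFun.symm.toContinuousLinearEquiv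
  have hA : ∀ s, A s = ∑ j, s j • v j := by
    intro s
    simp [A, b, Module.Basis.equivFun_symm_apply]
  obtain ⟨κ, hκ⟩ : ∃ κ : ℝ≥0, Measure.map A volume =
      κ • (volume : Measure (EuclideanSpace ℝ (Fin n))) :=
    ⟨_, Measure.isAddLeftInvariant_eq_smul (Measure.map A volume) volume⟩
  refine ⟨κ, fun x S hS => ?_⟩
  have h1 : {s : Fin n → ℝ | x + ∑ j, s j • v j ∈ S} = A ⁻¹' ((fun y => x + y) ⁻¹' S) := by
    ext s; simp [hA]
  have hT : MeasurableSet ((fun y => x + y) ⁻¹' S) := measurable_const_add x hS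
  rw [h1, ← Measure.map_apply A.continuous.measurable hT, hκ]
  rw [Measure.smul_apply, measure_preimage_add, ENNReal.smul_def, smul_eq_mul]

end IterHalo

/-! ### Boxes inside balls and the Solyanik estimate. -/

/-- The skew frame `σ e_i + e_j / 2` around the axis direction `σ e_i`. -/
noncomputable def axisFrame {n : ℕ} (i : Fin n) (σ : ℝ) (j : Fin n) : EuclideanSpace ℝ (Fin n) :=
  σ • EuclideanSpace.single i 1 + (1 / 2 : ℝ) • EuclideanSpace.single j 1

section Frames

variable {n : ℕ}

/-- The coordinates `k ≠ i` force `g k = 0`; coordinate `i` then leaves `(σ + 1 / 2) * g i = 0`, and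
`σ + 1 / 2 ≠ 0`. -/
theorem linearIndependent_axisFrame (i : Fin n) {σ : ℝ} (hσ : σ = 1 ∨ σ = -1) :
    LinearIndependent ℝ (axisFrame i σ) := by
  rw [Fintype.linearIndependent_iff]
  intro g hg
  have hcoord : ∀ k, (if k = i then σ * ∑ j, g j else 0) + g k / 2 = 0 := by
    intro k
    have h := congrArg (fun w : EuclideanSpace ℝ (Fin n) => w k) hg
    simp only [axisFrame, smul_add, Finset.sum_add_distrib, ← Finset.sum_smul, PiLp.add_apply,
      WithLp.ofLp_sum, Finset.sum_apply, PiLp.smul_apply, PiLp.single_apply,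
      PiLp.zero_apply, smul_eq_mul] at h
    have h2 : ∑ c, g c * (1 / 2 * if k = c then 1 else 0) = g k / 2 := by
      simp [div_eq_mul_inv]
    rw [h2] at h
    split_ifs at h ⊢ <;> linarith
  have hne : ∀ k, k ≠ i → g k = 0 := by
    intro k hk
    have := hcoord k
    rw [if_neg hk] at this
    linarith
  have hsum : ∑ j, g j = g i := Finset.sum_eq_single i (fun j _ hj => hne j hj) (by simp)
  intro k
  by_cases hk : k = i
  · subst hk
    have := hcoord k
    rw [if_pos rfl, hsum] at this
    rcases hσ with rfl | rfl <;> linarith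
  · exact hne k hk

/-- Every point of a ball is the vertex of a parallelepiped inside the ball, of comparable size and
spanned by one of finitely many frames. -/
theorem exists_axisFrame_box_subset_ball (hn : 1 ≤ n) {y : EuclideanSpace ℝ (Fin n)} {r ρ : ℝ}
    (hy : ‖y‖ < r) (hρ : ρ ≤ 2 * r / (9 * n ^ 2)) :
    ∃ i : Fin n, ∃ σ : ℝ, (σ = 1 ∨ σ = -1) ∧ ∀ s : Fin n → ℝ, (∀ j, s j ∈ Ioc 0 ρ) →
      ‖y + ∑ j, s j • axisFrame i σ j‖ < r := by
  have : Nonempty (Fin n) := ⟨⟨0, hn⟩⟩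
  have hn' : (1 : ℝ) ≤ n := by exact_mod_cast hn
  have hr : 0 < r := (norm_nonneg y).trans_lt hy
  -- The largest coordinate, with the sign `σ` pointing back to the centre: every frame vector then
  -- has inner product at most `-|y i| / 2` with `y`, since `y j / 2 ≤ |y i| / 2`.
  obtain ⟨i, hi⟩ := Finite.exists_max fun j => |y j|
  obtain ⟨σ, hσ, hσy⟩ : ∃ σ : ℝ, (σ = 1 ∨ σ = -1) ∧ σ * y i = -|y i| := by
    rcases le_total 0 (y i) with h | h
    · exact ⟨-1, Or.inr rfl, by rw [abs_of_nonneg h]; ring⟩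
    · exact ⟨1, Or.inl rfl, by rw [abs_of_nonpos h]; ring⟩
  refine ⟨i, σ, hσ, fun s hs => ?_⟩
  set w := ∑ j, s j • axisFrame i σ j with hw
  set S := ∑ j, s j with hS
  have hS0 : 0 ≤ S := Finset.sum_nonneg fun j _ => (hs j).1.le
  have hSn : S ≤ 2 * r / (9 * n) := by
    calc S ≤ ∑ _j : Fin n, ρ := Finset.sum_le_sum fun j _ => (hs j).2
      _ = n * ρ := by simp
      _ ≤ n * (2 * r / (9 * n ^ 2)) := by gcongr
      _ = _ := by field_simp
  have habs : |σ| = 1 := by rcases hσ with rfl | rfl <;> simp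
  have hvn : ∀ j, ‖axisFrame i σ j‖ ≤ 3 / 2 := by
    intro j
    refine (norm_add_le _ _).trans (le_of_eq ?_)
    rw [norm_smul, norm_smul, Real.norm_eq_abs, habs]
    simp
    norm_num
  have hwn : ‖w‖ ≤ 3 / 2 * S := by
    rw [hS, Finset.mul_sum]
    refine (norm_sum_le _ _).trans (Finset.sum_le_sum fun j _ => ?_)
    rw [norm_smul, Real.norm_eq_abs, abs_of_pos (hs j).1, mul_comm]
    exact mul_le_mul_of_nonneg_right (hvn j) (hs j).1.le
  have hin : inner ℝ y w ≤ -(|y i| / 2) * S := by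
    rw [hw, inner_sum, hS, Finset.mul_sum]
    refine Finset.sum_le_sum fun j _ => ?_
    rw [inner_smul_right, mul_comm]
    refine mul_le_mul_of_nonneg_right ?_ (hs j).1.le
    have : inner ℝ y (axisFrame i σ j) = σ * y i + y j / 2 := by
      rw [axisFrame, inner_add_right, inner_smul_right, inner_smul_right]
      simp [EuclideanSpace.inner_single_right]
      ring
    rw [this, hσy]
    linarith [hi j, le_abs_self (y j)]
  -- Near the centre, `‖w‖ ≤ r / 3` suffices. Otherwise `|y i| ≥ r / (2 n)`, and the bound on `ρ` is
  -- exactly what gives `9 / 4 * S ≤ |y i|`, so that the inward drift `|y i| * S` absorbs `‖w‖ ^ 2 ≤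
  -- 9 / 4 * S ^ 2`.
  rcases lt_or_ge ‖y‖ (r / 2) with hlt | hge
  · have h1 : 2 * r / (9 * n) ≤ 2 * r / 9 := by
      apply div_le_div_of_nonneg_left <;> linarith
    have := norm_add_le y w
    linarith
  · have hyi : r / (2 * n) ≤ |y i| := by
      have h2 : ‖y‖ ^ 2 ≤ (n * |y i|) ^ 2 := by
        rw [EuclideanSpace.norm_sq_eq]
        calc ∑ j, ‖y j‖ ^ 2 ≤ ∑ _j : Fin n, |y i| ^ 2 := Finset.sum_le_sum fun j _ => by
              rw [Real.norm_eq_abs]; exact pow_le_pow_left₀ (abs_nonneg _) (hi j) 2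
          _ = n * |y i| ^ 2 := by simp
          _ ≤ (n * n) * |y i| ^ 2 := by gcongr; nlinarith
          _ = _ := by ring
      have h3 := abs_le_of_sq_le_sq h2 (by positivity)
      rw [abs_of_nonneg (norm_nonneg _)] at h3
      rw [div_le_iff₀ (by positivity)]
      nlinarith
    have h94 : 9 / 4 * S ≤ |y i| := by
      refine le_trans ?_ hyi
      calc 9 / 4 * S ≤ 9 / 4 * (2 * r / (9 * n)) := by gcongr
        _ = r / (2 * n) := by field_simp; ring
    have hsq : ‖y + w‖ ^ 2 ≤ ‖y‖ ^ 2 := by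
      rw [norm_add_sq_real]
      have : ‖w‖ ^ 2 ≤ (3 / 2 * S) ^ 2 := pow_le_pow_left₀ (norm_nonneg _) hwn 2
      nlinarith
    exact (abs_le_of_sq_le_sq hsq (norm_nonneg _)).trans' (le_abs_self _) |>.trans_lt hy

theorem exists_dyadic_mem_Icc {c : ℝ} (hc : 0 < c) :
    ∃ m k : ℕ, c ≤ (k : ℝ) / 2 ^ m ∧ (k : ℝ) / 2 ^ m ≤ 2 * c := by
  obtain ⟨m, hm⟩ := exists_pow_lt_of_lt_one hc (show (1 / 2 : ℝ) < 1 by norm_num)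
  have hp : (0 : ℝ) < 2 ^ m := by positivity
  rw [one_div_pow, div_lt_iff₀ hp] at hm
  refine ⟨m, ⌈c * 2 ^ m⌉₊, ?_, ?_⟩
  · rw [le_div_iff₀ hp]
    exact Nat.le_ceil _
  · rw [div_le_iff₀ hp]
    have := Nat.ceil_lt_add_one (show 0 ≤ c * 2 ^ m by positivity)
    linarith

theorem volume_ball_eq (x : EuclideanSpace ℝ (Fin n)) {r : ℝ} (hr : 0 < r) :
    volume (Metric.ball x r) =
      ENNReal.ofReal (r ^ n) * volume (Metric.ball (0 : EuclideanSpace ℝ (Fin n)) 1) := by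
  simpa using Measure.addHaar_ball_of_pos (volume : Measure (EuclideanSpace ℝ (Fin n))) x hr

/-- **Solyanik's estimate for balls**, with exponent `1 / n`: a set `E` has an enlargement, of
measure at most `lam⁻ᴺ |E|`, that contains every ball in which `E` misses a proportion less than
`c (1 - lam) ^ n`. -/
theorem exists_enlargement (hn : 1 ≤ n) : ∃ c : ℝ, 0 < c ∧ c ≤ 1 ∧ ∃ N : ℕ,
    ∀ lam : ℝ, 0 < lam → lam < 1 → ∀ E : Set (EuclideanSpace ℝ (Fin n)),
      MeasurableSet E → volume E ≠ ∞ → ∃ E' ⊇ E, MeasurableSet E' ∧ volume E' ≠ ∞ ∧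
        ENNReal.ofReal lam ^ N * volume E' ≤ volume E ∧
        ∀ x r, 0 < r → volume (Metric.ball x r \ E) <
          ENNReal.ofReal (c * (1 - lam) ^ n) * volume (Metric.ball x r) →
          Metric.ball x r ⊆ E' := by
  have hn' : (1 : ℝ) ≤ n := by exact_mod_cast hn
  let sgn : Bool → ℝ := fun b => if b then 1 else -1
  have hsgn : ∀ b, sgn b = 1 ∨ sgn b = -1 := by intro b; cases b <;> simp [sgn]
  have hκ := fun p : Fin n × Bool =>
    exists_volume_linear_preimage_eq (linearIndependent_axisFrame p.1 (hsgn p.2))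
  choose κ hκ using hκ
  obtain ⟨K, hK⟩ := Finite.exists_le κ
  set ω : ℝ := (volume (Metric.ball (0 : EuclideanSpace ℝ (Fin n)) 1)).toReal with hω
  have hω0 : 0 ≤ ω := ENNReal.toReal_nonneg
  set q : ℝ := (1 / (9 * n ^ 2)) ^ n with hq
  have hq0 : 0 < q := by positivity
  -- Chosen so that `K * c * ω ≤ q`: the box forces a missing volume `≥ q ((1 - lam) r) ^ n / K`,
  -- while the hypothesis on the ball allows less than `c ω ((1 - lam) r) ^ n`. The added ones keep
  -- the denominator positive.
  set c : ℝ := min 1 (q / ((K + 1) * (ω + 1))) with hc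
  have hc0 : 0 < c := lt_min one_pos (by positivity)
  have hcq : K * (c * ω) ≤ q := by
    have h1 : c * ((K + 1) * (ω + 1)) ≤ q := by
      rw [← le_div_iff₀ (by positivity)]; exact min_le_right _ _
    have : 0 ≤ (K : ℝ) := K.coe_nonneg
    nlinarith [mul_nonneg hc0.le hω0, mul_nonneg hc0.le this]
  set frames : List (EuclideanSpace ℝ (Fin n)) :=
    (Finset.univ : Finset (Fin n × Bool)).toList.flatMap
      fun p => List.ofFn (axisFrame p.1 (sgn p.2)) with hfr
  refine ⟨c, hc0, min_le_left _ _, frames.length, fun lam h0 h1 E hE hfin => ?_⟩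
  have hvol := volume_iterHalo_le (L := frames) h0 h1 hE hfin
  refine ⟨iterHalo frames lam E, subset_iterHalo, measurableSet_iterHalo hE, hvol.2, hvol.1,
    fun x r hr hlt y hy => ?_⟩
  by_contra hyE
  obtain ⟨m, k, hk1, hk2⟩ := exists_dyadic_mem_Icc (c := r / (9 * n ^ 2)) (by positivity)
  set ρ : ℝ := k / 2 ^ m with hρ
  have hyr : ‖y - x‖ < r := by rwa [← dist_eq_norm]
  obtain ⟨i, σ, hσ, hbox⟩ := exists_axisFrame_box_subset_ball hn hyr (hk2.trans_eq (by ring))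
  obtain ⟨b, rfl⟩ : ∃ b, σ = sgn b := by
    rcases hσ with rfl | rfl
    · exact ⟨true, rfl⟩
    · exact ⟨false, rfl⟩
  have hmem : (i, b) ∈ (Finset.univ : Finset (Fin n × Bool)).toList := by simp
  have hyE' : y ∉ iterHalo (List.ofFn (axisFrame i (sgn b))) lam E := fun h => hyE
    (iterHalo_subset_flatMap (fun p : Fin n × Bool => List.ofFn (axisFrame p.1 (sgn p.2)))
      hmem h)
  have hlow := le_volume_box_of_notMem_iterHalo h0.le hE m k _ hyE'
  have hup : volume {s : Fin n → ℝ | (∀ j, s j ∈ Ioc (0 : ℝ) ρ) ∧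
      y + ∑ j, s j • axisFrame i (sgn b) j ∉ E} ≤ K * volume (Metric.ball x r \ E) := by
    calc _ ≤ volume {s : Fin n → ℝ |
            y + ∑ j, s j • axisFrame i (sgn b) j ∈ Metric.ball x r \ E} := by
          refine measure_mono fun s hs => ⟨?_, hs.2⟩
          rw [mem_ball_iff_norm, add_sub_right_comm]
          exact hbox s hs.1
      _ = κ (i, b) * volume (Metric.ball x r \ E) :=
          hκ (i, b) y _ (measurableSet_ball.diff hE)
      _ ≤ _ := by gcongr; exact hK (i, b)
  have hchain := hlow.trans hup
  have hωtop : volume (Metric.ball (0 : EuclideanSpace ℝ (Fin n)) 1) = ENNReal.ofReal ω := by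
    rw [hω, ENNReal.ofReal_toReal measure_ball_lt_top.ne]
  rw [volume_ball_eq x hr, hωtop, ← ENNReal.ofReal_mul (by positivity),
    ← ENNReal.ofReal_mul (mul_nonneg hc0.le (pow_nonneg (by linarith) _))] at hlt
  have hdfin : volume (Metric.ball x r \ E) ≠ ∞ := ne_top_of_lt hlt
  set d : ℝ := (volume (Metric.ball x r \ E)).toReal with hd
  rw [← ENNReal.ofReal_toReal hdfin, ← hd] at hlt hchain
  have hd0 : 0 ≤ d := ENNReal.toReal_nonneg
  have hlam' : 0 < 1 - lam := by linarith
  rw [ENNReal.ofReal_lt_ofReal_iff_of_nonneg hd0] at hlt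
  rw [← ENNReal.ofReal_pow (by positivity), ← ENNReal.ofReal_coe_nnreal,
    ← ENNReal.ofReal_mul K.coe_nonneg, ENNReal.ofReal_le_ofReal_iff (by positivity)] at hchain
  have hbig : (1 - lam) ^ n * r ^ n * q ≤ K * d := by
    refine le_trans (le_of_eq ?_) ((pow_le_pow_left₀ (by positivity)
      (mul_le_mul_of_nonneg_left hk1 hlam'.le) n).trans hchain)
    rw [hq, ← mul_pow, ← mul_pow]
    congr 1; ring
  have hP : 0 < (1 - lam) ^ n * r ^ n := by positivity
  rcases K.coe_nonneg.eq_or_lt with hK0 | hK0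
  · rw [← hK0, zero_mul] at hbig
    nlinarith [mul_pos hP hq0]
  · have : (K : ℝ) * d < K * (c * (1 - lam) ^ n * (r ^ n * ω)) := by
      exact mul_lt_mul_of_pos_left hlt hK0
    nlinarith [mul_le_mul_of_nonneg_left hcq hP.le]

end Frames

/-! ### Gain of density in the balls that are not swallowed. -/

section Gain

variable {n : ℕ} {E E' : Set (EuclideanSpace ℝ (Fin n))}

theorem volume_real_ball (x : EuclideanSpace ℝ (Fin n)) {r : ℝ} (hr : 0 < r) :
    volume.real (Metric.ball x r) =
      r ^ n * volume.real (Metric.ball (0 : EuclideanSpace ℝ (Fin n)) 1) := by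
  rw [measureReal_def, volume_ball_eq x hr, ENNReal.toReal_mul,
    ENNReal.toReal_ofReal (by positivity), measureReal_def]

theorem volume_closedBall_eq_ball (x : EuclideanSpace ℝ (Fin n)) {r : ℝ} (hr : 0 < r) :
    volume (Metric.closedBall x r) = volume (Metric.ball x r) := by
  rw [Measure.addHaar_closedBall _ x hr.le, Measure.addHaar_ball_of_pos _ x hr]

theorem volume_real_ball_pos (x : EuclideanSpace ℝ (Fin n)) {r : ℝ} (hr : 0 < r) :
    0 < volume.real (Metric.ball x r) :=
  ENNReal.toReal_pos (Metric.measure_ball_pos volume x hr).ne' measure_ball_lt_top.ne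

/-- These are the images of one ball under homotheties centred at `x`; they increase with the ratio
because `x` lies in the closed ball. -/
theorem ball_homothety_subset {x c : EuclideanSpace ℝ (Fin n)} {r a b : ℝ} (hx : dist x c ≤ r)
    (hab : a ≤ b) :
    Metric.ball (x + a • (c - x)) (a * r) ⊆ Metric.ball (x + b • (c - x)) (b * r) := by
  apply Metric.ball_subset_ball'
  have : x + a • (c - x) - (x + b • (c - x)) = (b - a) • (x - c) := by module
  rw [dist_eq_norm, this, norm_smul, ← dist_eq_norm x, Real.norm_eq_abs,
    abs_of_nonneg (sub_nonneg.2 hab)]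
  nlinarith [mul_le_mul_of_nonneg_left hx (sub_nonneg.2 hab)]

/-- Shrinking a ball towards a density point of `E` inside it, one meets any prescribed smaller
positive proportion of the complement of `E`. -/
theorem exists_homothetic_ball_of_density (hE : MeasurableSet E)
    {x c : EuclideanSpace ℝ (Fin n)} {r σ : ℝ} (hr : 0 < r) (hσ : 0 < σ) (hxc : dist x c ≤ r)
    (hbig : σ * volume.real (Metric.ball c r) ≤ volume.real (Metric.ball c r \ E))
    (hdens : Filter.Tendsto (fun τ : ℝ =>
      volume (E ∩ Metric.closedBall (x + τ • (c - x)) (τ * r)) /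
        volume (Metric.closedBall (x + τ • (c - x)) (τ * r))) (nhdsWithin 0 (Ioi 0)) (nhds 1)) :
    ∃ τ : ℝ, 0 < τ ∧ τ ≤ 1 ∧ volume.real (Metric.ball (x + τ • (c - x)) (τ * r) \ E) =
      σ * volume.real (Metric.ball (x + τ • (c - x)) (τ * r)) := by
  set B : ℝ → Set (EuclideanSpace ℝ (Fin n)) :=
    fun τ => Metric.ball (x + τ • (c - x)) (τ * r) with hB
  set ω := volume.real (Metric.ball (0 : EuclideanSpace ℝ (Fin n)) 1) with hω
  have hfin : ∀ τ, volume (B τ) ≠ ∞ := fun τ => measure_ball_lt_top.ne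
  have hV : ∀ τ, 0 < τ → volume.real (B τ) = (τ * r) ^ n * ω := fun τ hτ =>
    volume_real_ball _ (by positivity)
  have hdecomp : ∀ τ, volume.real (B τ) = volume.real (B τ ∩ E) + volume.real (B τ \ E) :=
    fun τ => (measureReal_inter_add_sdiff hE (h := hfin τ)).symm
  obtain ⟨τ₀, hτ₀, hτ₀1, hsmall⟩ : ∃ τ₀ : ℝ, 0 < τ₀ ∧ τ₀ < 1 ∧
      volume.real (B τ₀ \ E) < σ * volume.real (B τ₀) := by
    have h1 : ENNReal.ofReal (1 - σ) < 1 := by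
      rw [← ENNReal.ofReal_one, ENNReal.ofReal_lt_ofReal_iff one_pos]; linarith
    have hev := hdens.eventually (lt_mem_nhds h1)
    obtain ⟨τ, hτ, hτlt, hτpos⟩ := (hev.and (Ioo_mem_nhdsGT (zero_lt_one (α := ℝ)))).exists
    refine ⟨τ, hτlt, hτpos, ?_⟩
    set C := Metric.closedBall (x + τ • (c - x)) (τ * r) with hC
    have hBC : volume.real C = volume.real (B τ) :=
      congrArg ENNReal.toReal (volume_closedBall_eq_ball _ (mul_pos hτlt hr))
    have hCfin : volume C ≠ ∞ := measure_closedBall_lt_top.ne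
    have hICfin : volume (C ∩ E) ≠ ∞ := ne_top_of_le_ne_top hCfin (measure_mono inter_subset_left)
    have h2 : (1 - σ) * volume.real C < volume.real (C ∩ E) := by
      rw [inter_comm] at hτ
      have h3 := ENNReal.mul_lt_of_lt_div hτ
      have h4 := (ENNReal.toReal_lt_toReal (by finiteness) hICfin).2 h3
      rw [ENNReal.toReal_mul, ENNReal.toReal_ofReal'] at h4
      exact lt_of_le_of_lt (mul_le_mul_of_nonneg_right (le_max_left _ _) measureReal_nonneg) h4
    have h5 : volume.real C = volume.real (C ∩ E) + volume.real (C \ E) :=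
      (measureReal_inter_add_sdiff hE (h := hCfin)).symm
    have h6 : volume.real (B τ \ E) ≤ volume.real (C \ E) :=
      measureReal_mono (sdiff_subset_sdiff_left Metric.ball_subset_closedBall)
        (ne_top_of_le_ne_top hCfin (measure_mono sdiff_subset))
    rw [← hBC]
    linarith
  have hcont : ContinuousOn (fun τ => volume.real (B τ \ E) - σ * ((τ * r) ^ n * ω)) (Icc τ₀ 1) := by
    have hg : ContinuousOn (fun τ => volume.real (B τ \ E)) (Icc τ₀ 1) := by
      have hc : ContinuousOn (fun τ : ℝ => (τ * r) ^ n * ω) (Icc τ₀ 1) := by fun_prop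
      -- The balls are nested, so the part outside `E` varies no more than the whole ball, whose
      -- volume is continuous in the ratio.
      have hle : ∀ a b, 0 < a → a ≤ b → |volume.real (B b \ E) - volume.real (B a \ E)| ≤
          |(b * r) ^ n * ω - (a * r) ^ n * ω| := by
        intro a b ha hab
        have hsub : B a ⊆ B b := ball_homothety_subset hxc hab
        have h1 : volume.real (B a \ E) ≤ volume.real (B b \ E) :=
          measureReal_mono (sdiff_subset_sdiff_left hsub)
            (ne_top_of_le_ne_top (hfin b) (measure_mono sdiff_subset))
        have h2 : volume.real (B a ∩ E) ≤ volume.real (B b ∩ E) :=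
          measureReal_mono (inter_subset_inter_left _ hsub)
            (ne_top_of_le_ne_top (hfin b) (measure_mono inter_subset_left))
        rw [← hV a ha, ← hV b (ha.trans_le hab), abs_of_nonneg (sub_nonneg.2 h1)]
        refine le_trans ?_ (le_abs_self _)
        rw [hdecomp a, hdecomp b]
        linarith
      rw [Metric.continuousOn_iff] at hc ⊢
      intro b hb ε hε
      obtain ⟨δ, hδ, h⟩ := hc b hb ε hε
      refine ⟨δ, hδ, fun a ha hab => lt_of_le_of_lt ?_ (h a ha hab)⟩
      rw [Real.dist_eq, Real.dist_eq]
      rcases le_total a b with hl | hl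
      · rw [abs_sub_comm, abs_sub_comm (_ * _)]
        exact hle a b (hτ₀.trans_le ha.1) hl
      · exact hle b a (hτ₀.trans_le hb.1) hl
    exact hg.sub (by fun_prop)
  have hB1 : B 1 = Metric.ball c r := by simp [hB]
  have hivt := intermediate_value_Icc hτ₀1.le hcont
  have h0 : (0 : ℝ) ∈ Icc (volume.real (B τ₀ \ E) - σ * ((τ₀ * r) ^ n * ω))
      (volume.real (B 1 \ E) - σ * ((1 * r) ^ n * ω)) := by
    rw [← hV τ₀ hτ₀, ← hV 1 one_pos, hB1]
    exact ⟨by linarith, by linarith⟩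
  obtain ⟨τ, hτ, hτ0⟩ := hivt h0
  have hpos : 0 < τ := hτ₀.trans_le hτ.1
  refine ⟨τ, hpos, hτ.2, ?_⟩
  change volume.real (B τ \ E) = σ * volume.real (B τ)
  rw [hV τ hpos]
  simp only at hτ0
  linarith

/-- If `E'` contains every ball in which `E` misses a proportion less than `s`, then in every other
ball `E'` has measure at least `1 + s / (2 * 5 ^ n)` times that of `E`. -/
theorem volume_inter_ball_gain (hE : MeasurableSet E) (hsub : E ⊆ E') {s : ℝ} (hs : 0 < s)
    (hfill : ∀ x r, 0 < r → volume (Metric.ball x r \ E) <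
      ENNReal.ofReal s * volume (Metric.ball x r) → Metric.ball x r ⊆ E')
    {c : EuclideanSpace ℝ (Fin n)} {r : ℝ} (hr : 0 < r)
    (hbig : ENNReal.ofReal s * volume (Metric.ball c r) ≤ volume (Metric.ball c r \ E)) :
    ENNReal.ofReal (1 + s / (2 * 5 ^ n)) * volume (E ∩ Metric.ball c r) ≤
      volume (E' ∩ Metric.ball c r) := by
  -- Halving `s` makes the missing proportion of the selected balls strictly less than `s`, so
  -- `hfill` puts them inside `E'`.
  have hbig' : s / 2 * volume.real (Metric.ball c r) ≤ volume.real (Metric.ball c r \ E) := by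
    have h := ENNReal.toReal_mono (ne_top_of_le_ne_top measure_ball_lt_top.ne
      (measure_mono sdiff_subset)) hbig
    rw [ENNReal.toReal_mul, ENNReal.toReal_ofReal hs.le] at h
    have := volume_real_ball_pos c hr
    simp only [measureReal_def] at this ⊢
    nlinarith
  have hdens := IsUnifLocDoublingMeasure.ae_tendsto_measure_inter_div
    (volume : Measure (EuclideanSpace ℝ (Fin n))) E 1
  rw [ae_restrict_iff' hE] at hdens
  set A : Set (EuclideanSpace ℝ (Fin n)) := {x | x ∈ E ∩ Metric.ball c r ∧
    ∃ τ : ℝ, 0 < τ ∧ τ ≤ 1 ∧ volume.real (Metric.ball (x + τ • (c - x)) (τ * r) \ E) =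
      s / 2 * volume.real (Metric.ball (x + τ • (c - x)) (τ * r))} with hA
  have hAE : volume (E ∩ Metric.ball c r) ≤ volume A := by
    refine measure_mono_ae ?_
    filter_upwards [hdens] with x hx hxE
    refine ⟨hxE, exists_homothetic_ball_of_density hE hr (half_pos hs)
      (Metric.mem_ball.1 hxE.2).le hbig' ?_⟩
    refine hx hxE.1 (fun τ : ℝ => x + τ • (c - x)) (fun τ => τ * r) ?_ ?_
    · refine tendsto_nhdsWithin_iff.2 ⟨?_, ?_⟩
      · have : Continuous fun τ : ℝ => τ * r := by fun_prop
        simpa using (this.tendsto 0).mono_left nhdsWithin_le_nhds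
      · filter_upwards [self_mem_nhdsWithin] with τ hτ
        exact mul_pos hτ hr
    · filter_upwards [self_mem_nhdsWithin] with τ hτ
      have hτ' : (0 : ℝ) < τ := hτ
      rw [Metric.mem_closedBall, dist_comm, dist_eq_norm, add_sub_cancel_left, norm_smul,
        Real.norm_eq_abs, abs_of_pos hτ', one_mul, ← dist_eq_norm, dist_comm]
      exact mul_le_mul_of_nonneg_left (Metric.mem_ball.1 hxE.2).le hτ'.le
  choose! τ hτ0 hτ1 hτ using fun x (hx : x ∈ A) => hx.2
  set w := fun x => x + τ x • (c - x) with hw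
  -- The source of the factor `5 ^ n`: disjoint selected balls whose fivefold dilates cover almost
  -- all of `E` in the ball. Each contributes half of `s` times its volume to `E' \ E`.
  obtain ⟨u, huA, hdisj, hcov⟩ := Vitali.exists_disjoint_subfamily_covering_enlargement_closedBall
    A w (fun x => τ x * r) r (fun x hx => mul_le_of_le_one_left hr.le (hτ1 x hx)) 5 (by norm_num)
  have hdisj' : u.PairwiseDisjoint fun x => Metric.ball (w x) (τ x * r) := fun a ha b hb hab =>
    (hdisj ha hb hab).mono Metric.ball_subset_closedBall Metric.ball_subset_closedBall
  have hpos : ∀ x ∈ u, 0 < τ x * r := fun x hx => mul_pos (hτ0 x (huA hx)) hr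
  have hucount : u.Countable := hdisj'.countable_of_isOpen (fun _ _ => Metric.isOpen_ball)
    fun x hx => Metric.nonempty_ball.2 (hpos x hx)
  have hdiff : ∀ x ∈ u, volume (Metric.ball (w x) (τ x * r) \ E) =
      ENNReal.ofReal (s / 2) * volume (Metric.ball (w x) (τ x * r)) := by
    intro x hx
    have h := congrArg ENNReal.ofReal (hτ x (huA hx))
    rwa [ofReal_measureReal (ne_top_of_le_ne_top measure_ball_lt_top.ne
      (measure_mono sdiff_subset)), ENNReal.ofReal_mul (half_pos hs).le,
      ofReal_measureReal measure_ball_lt_top.ne] at h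
  have hcover : A ⊆ ⋃ x ∈ u, Metric.closedBall (w x) (5 * (τ x * r)) := by
    intro x hx
    obtain ⟨b, hb, hsubb⟩ := hcov x hx
    refine mem_iUnion₂.2 ⟨b, hb, hsubb ?_⟩
    rw [Metric.mem_closedBall, dist_comm, dist_eq_norm, hw, add_sub_cancel_left, norm_smul,
      Real.norm_eq_abs, abs_of_pos (hτ0 x hx), ← dist_eq_norm, dist_comm]
    exact mul_le_mul_of_nonneg_left (Metric.mem_ball.1 hx.1.2).le (hτ0 x hx).le
  have h5 : volume A ≤ ENNReal.ofReal (5 ^ n) *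
      ∑' x : u, volume (Metric.ball (w x) (τ x * r)) := by
    calc volume A ≤ ∑' x : u, volume (Metric.closedBall (w x) (5 * (τ x * r))) :=
          (measure_mono hcover).trans (measure_biUnion_le _ hucount _)
      _ = ∑' x : u, ENNReal.ofReal (5 ^ n) * volume (Metric.ball (w x) (τ x * r)) := by
          refine tsum_congr fun x => ?_
          have hp := hpos x x.2
          rw [volume_closedBall_eq_ball _ (by positivity), volume_ball_eq _ (by positivity),
            volume_ball_eq _ hp, mul_pow, ENNReal.ofReal_mul (by positivity), mul_assoc]
      _ = _ := ENNReal.tsum_mul_left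
  have hgain : ENNReal.ofReal (s / 2) * ∑' x : u, volume (Metric.ball (w x) (τ x * r)) ≤
      volume ((E' ∩ Metric.ball c r) \ E) := by
    rw [← ENNReal.tsum_mul_left, ← tsum_congr fun x : u => hdiff x x.2, ← measure_biUnion hucount
      (hdisj'.mono fun x => sdiff_subset) fun x _ => measurableSet_ball.diff hE]
    refine measure_mono (iUnion₂_subset fun x hx => ?_)
    refine sdiff_subset_sdiff_left (subset_inter (hfill _ _ (hpos x hx) ?_) ?_)
    · rw [hdiff x hx]
      refine ENNReal.mul_lt_mul_left (Metric.measure_ball_pos volume _ (hpos x hx)).ne'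
        measure_ball_lt_top.ne ?_
      rw [ENNReal.ofReal_lt_ofReal_iff hs]
      exact half_lt_self hs
    · have := ball_homothety_subset (Metric.mem_ball.1 (huA hx).1.2).le (hτ1 x (huA hx))
      simpa using this
  have hfinal : ENNReal.ofReal (s / (2 * 5 ^ n)) * volume (E ∩ Metric.ball c r) ≤
      volume ((E' ∩ Metric.ball c r) \ E) := by
    refine le_trans ?_ hgain
    calc _ ≤ ENNReal.ofReal (s / (2 * 5 ^ n)) * (ENNReal.ofReal (5 ^ n) *
          ∑' x : u, volume (Metric.ball (w x) (τ x * r))) := by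
          gcongr; exact hAE.trans h5
      _ = _ := by
          rw [← mul_assoc, ← ENNReal.ofReal_mul (by positivity)]
          congr 2
          field_simp
  rw [ENNReal.ofReal_add zero_le_one (by positivity), add_mul, ENNReal.ofReal_one, one_mul,
    ← measure_inter_add_sdiff (E' ∩ Metric.ball c r) hE]
  refine add_le_add (measure_mono fun x hx => ?_) hfinal
  exact ⟨⟨hsub hx.1, hx.2⟩, hx.1⟩

end Gain

/-! ### Self-improvement of the Tauberian constants. -/

section Tauberian

variable {n : ℕ} {α β : ℝ} {E F : Set (EuclideanSpace ℝ (Fin n))}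

theorem mem_haloSet_iff (hE : MeasurableSet E) {x : EuclideanSpace ℝ (Fin n)} :
    x ∈ haloSet (ballBasis n) α E ↔ ∃ c r, 0 < r ∧ x ∈ Metric.ball c r ∧
      ENNReal.ofReal α * volume (Metric.ball c r) < volume (E ∩ Metric.ball c r) := by
  have hint : ∀ R : Set (EuclideanSpace ℝ (Fin n)),
      ∫⁻ y in R, ‖E.indicator (fun _ => (1 : ℝ)) y‖ₑ = volume (E ∩ R) := by
    intro R
    rw [← Measure.restrict_apply hE, ← lintegral_indicator_one hE]
    refine lintegral_congr fun y => ?_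
    by_cases hy : y ∈ E <;> simp [hy]
  have hdiv : ∀ c : EuclideanSpace ℝ (Fin n), ∀ r : ℝ, 0 < r →
      (ENNReal.ofReal α < volume (E ∩ Metric.ball c r) / volume (Metric.ball c r) ↔
      ENNReal.ofReal α * volume (Metric.ball c r) < volume (E ∩ Metric.ball c r)) :=
    fun c r hr => ENNReal.lt_div_iff_mul_lt
      (Or.inl (Metric.measure_ball_pos volume c hr).ne') (Or.inl measure_ball_lt_top.ne)
  simp only [haloSet, maximalOp, mem_ofPred_eq, lt_iSup_iff, hint, ballBasis]
  constructor
  · rintro ⟨R, ⟨⟨c, r, hr, rfl⟩, hx⟩, h⟩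
    exact ⟨c, r, hr, hx, (hdiv c r hr).1 h⟩
  · rintro ⟨c, r, hr, hx, h⟩
    exact ⟨_, ⟨⟨c, r, hr, rfl⟩, hx⟩, (hdiv c r hr).2 h⟩

theorem haloSet_antitone (B : Set (Set (EuclideanSpace ℝ (Fin n)))) (h : α ≤ β) :
    haloSet B β E ⊆ haloSet B α E :=
  fun _ hx => (ENNReal.ofReal_le_ofReal h).trans_lt hx

theorem tauberianConst_antitone (B : Set (Set (EuclideanSpace ℝ (Fin n)))) :
    Antitone (tauberianConst B) := fun _ _ h =>
  iSup₂_mono fun _ _ => ENNReal.div_le_div_right (measure_mono (haloSet_antitone B h)) _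

theorem volume_haloSet_le (B : Set (Set (EuclideanSpace ℝ (Fin n)))) (hE : MeasurableSet E)
    (h0 : volume E ≠ 0) (hfin : volume E ≠ ∞) :
    volume (haloSet B α E) ≤ tauberianConst B α * volume E := by
  rw [← ENNReal.div_le_iff h0 hfin]
  exact le_iSup₂ (f := fun E (_ : E ∈ {E : Set (EuclideanSpace ℝ (Fin n)) |
      MeasurableSet E ∧ 0 < volume E ∧ volume E < ∞}) => volume (haloSet B α E) / volume E) E
    ⟨hE, pos_iff_ne_zero.2 h0, hfin.lt_top⟩

theorem mul_tauberianConst_le {B : Set (Set (EuclideanSpace ℝ (Fin n)))} {t K : ℝ≥0∞}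
    (h : ∀ E, MeasurableSet E → volume E ≠ 0 → volume E ≠ ∞ →
      t * volume (haloSet B α E) ≤ K * volume E) :
    t * tauberianConst B α ≤ K := by
  rw [tauberianConst, ENNReal.mul_iSup]
  refine iSup_le fun E => ?_
  rw [ENNReal.mul_iSup]
  refine iSup_le fun hE => ?_
  rw [← mul_div_assoc, ENNReal.div_le_iff hE.2.1.ne' hE.2.2.ne]
  exact h E hE.1 hE.2.1.ne' hE.2.2.ne

theorem one_le_tauberianConst (h : α < 1) : 1 ≤ tauberianConst (ballBasis n) α := by
  set U : Set (EuclideanSpace ℝ (Fin n)) := Metric.ball 0 1 with hU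
  have hpos : volume U ≠ 0 := (Metric.measure_ball_pos volume _ one_pos).ne'
  have hfin : volume U ≠ ∞ := measure_ball_lt_top.ne
  have hsub : U ⊆ haloSet (ballBasis n) α U := by
    intro x hx
    refine (mem_haloSet_iff measurableSet_ball).2 ⟨0, 1, one_pos, hx, ?_⟩
    rw [inter_self]
    conv_rhs => rw [← one_mul (volume _)]
    refine ENNReal.mul_lt_mul_left hpos hfin ?_
    rw [← ENNReal.ofReal_one, ENNReal.ofReal_lt_ofReal_iff one_pos]
    exact h
  have := (measure_mono hsub).trans
    (volume_haloSet_le (ballBasis n) (α := α) measurableSet_ball hpos hfin)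
  rwa [← ENNReal.div_le_iff hpos hfin, ENNReal.div_self hpos hfin] at this

/-- The two self-improvement inequalities for the Tauberian constants of balls. -/
theorem exists_tauberianConst_le (hn : 1 ≤ n) :
    ∃ c d : ℝ, 0 < c ∧ c ≤ 1 ∧ 0 < d ∧ d ≤ 1 ∧ ∃ N : ℕ, ∀ lam : ℝ, 0 < lam → lam < 1 →
      (∀ α, 0 < α → α * (1 + c * (1 - lam) ^ n * d) < 1 →
        ENNReal.ofReal lam ^ N * tauberianConst (ballBasis n) α ≤
          tauberianConst (ballBasis n) (α * (1 + c * (1 - lam) ^ n * d))) ∧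
      (∀ α, 0 < α → α < 1 → 1 - c * (1 - lam) ^ n ≤ α →
        ENNReal.ofReal lam ^ N * tauberianConst (ballBasis n) α ≤ 1) := by
  obtain ⟨c, hc, hc1, N, hN⟩ := exists_enlargement hn
  have h5 : (1 : ℝ) ≤ 5 ^ n := one_le_pow₀ (by norm_num)
  refine ⟨c, 1 / (2 * 5 ^ n), hc, hc1, by positivity, ?_, N, fun lam h0 h1 => ⟨?_, ?_⟩⟩
  · rw [div_le_one (by positivity)]; linarith
  · intro α hα hα1
    set s : ℝ := c * (1 - lam) ^ n with hs
    have hs0 : 0 < s := mul_pos hc (pow_pos (by linarith) n)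
    have hsd : s * (1 / (2 * 5 ^ n)) = s / (2 * 5 ^ n) := by ring
    refine mul_tauberianConst_le fun E hE hE0 hEfin => ?_
    obtain ⟨E', hsub, hE', hE'fin, hvol, hfill⟩ := hN lam h0 h1 E hE hEfin
    -- A ball witnessing density above `α` is either swallowed, so its density in `E'` is 1, or has
    -- its density raised by the gain factor.
    have hhalo : haloSet (ballBasis n) α E ⊆
        haloSet (ballBasis n) (α * (1 + s * (1 / (2 * 5 ^ n)))) E' := by
      intro x hx
      obtain ⟨y, r, hr, hxB, hlt⟩ := (mem_haloSet_iff hE).1 hx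
      refine (mem_haloSet_iff hE').2 ⟨y, r, hr, hxB, ?_⟩
      have hBpos := (Metric.measure_ball_pos volume y hr).ne'
      have hBfin : volume (Metric.ball y r) ≠ ∞ := measure_ball_lt_top.ne
      rcases lt_or_ge (volume (Metric.ball y r \ E))
        (ENNReal.ofReal s * volume (Metric.ball y r)) with h | h
      · rw [inter_eq_self_of_subset_right (hfill y r hr h)]
        conv_rhs => rw [← one_mul (volume _)]
        refine ENNReal.mul_lt_mul_left hBpos hBfin ?_
        rw [← ENNReal.ofReal_one, ENNReal.ofReal_lt_ofReal_iff one_pos]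
        exact hα1
      · refine lt_of_lt_of_le ?_ (volume_inter_ball_gain hE hsub hs0 hfill hr h)
        rw [mul_comm α, ENNReal.ofReal_mul (by positivity), mul_assoc, hsd]
        exact ENNReal.mul_lt_mul_right
          (by rw [Ne, ENNReal.ofReal_eq_zero, not_le]; positivity) (by simp) hlt
    have hE'0 : volume E' ≠ 0 := (lt_of_lt_of_le (pos_iff_ne_zero.2 hE0) (measure_mono hsub)).ne'
    calc ENNReal.ofReal lam ^ N * volume (haloSet (ballBasis n) α E)
        ≤ ENNReal.ofReal lam ^ N * (tauberianConst (ballBasis n)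
            (α * (1 + s * (1 / (2 * 5 ^ n)))) * volume E') := by
          gcongr
          exact (measure_mono hhalo).trans (volume_haloSet_le _ hE' hE'0 hE'fin)
      _ = tauberianConst (ballBasis n) (α * (1 + s * (1 / (2 * 5 ^ n)))) *
            (ENNReal.ofReal lam ^ N * volume E') := by ring
      _ ≤ _ := by gcongr
  · intro α hα hα1 hle
    refine mul_tauberianConst_le fun E hE hE0 hEfin => ?_
    obtain ⟨E', hsub, hE', hE'fin, hvol, hfill⟩ := hN lam h0 h1 E hE hEfin
    -- Density above `α ≥ 1 - s` means that a proportion below `s` is missing, so every witnessing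
    -- ball is swallowed.
    have hhalo : haloSet (ballBasis n) α E ⊆ E' := by
      intro x hx
      obtain ⟨y, r, hr, hxB, hlt⟩ := (mem_haloSet_iff hE).1 hx
      refine hfill y r hr ?_ hxB
      have hBfin : volume (Metric.ball y r) ≠ ∞ := measure_ball_lt_top.ne
      have hIfin : volume (E ∩ Metric.ball y r) ≠ ∞ :=
        ne_top_of_le_ne_top hBfin (measure_mono inter_subset_right)
      have hpos := volume_real_ball_pos y hr
      have h2 := (ENNReal.toReal_lt_toReal (by finiteness) hIfin).2 hlt
      rw [ENNReal.toReal_mul, ENNReal.toReal_ofReal hα.le, inter_comm] at h2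
      have h3 : volume.real (Metric.ball y r) = volume.real (Metric.ball y r ∩ E) +
          volume.real (Metric.ball y r \ E) := (measureReal_inter_add_sdiff hE (h := hBfin)).symm
      have hs0 : 0 < c * (1 - lam) ^ n := mul_pos hc (pow_pos (by linarith) n)
      refine (ENNReal.toReal_lt_toReal (ne_top_of_le_ne_top hBfin (measure_mono sdiff_subset))
        (by finiteness)).1 ?_
      rw [ENNReal.toReal_mul, ENNReal.toReal_ofReal hs0.le]
      simp only [measureReal_def] at h3 hpos
      nlinarith
    calc _ ≤ ENNReal.ofReal lam ^ N * volume E' := by gcongr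
      _ ≤ _ := by rw [one_mul]; exact hvol

theorem tauberianConst_ballBasis_lt_top (hn : 1 ≤ n) (h0 : 0 < α) (h1 : α < 1) :
    tauberianConst (ballBasis n) α < ∞ := by
  obtain ⟨c, d, hc, hc1, hd, hd1, N, hN⟩ := exists_tauberianConst_le hn
  obtain ⟨hI, hII⟩ := hN (1 / 2) (by norm_num) (by norm_num)
  set s : ℝ := c * (1 - 1 / 2) ^ n with hs
  have hs0 : 0 < s := by positivity
  set q : ℝ := 1 + s * d with hq
  have hq1 : 1 < q := by have := mul_pos hs0 hd; linarith
  have hne : ENNReal.ofReal (1 / 2) ^ N ≠ 0 := by simp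
  have hlt : ∀ {t : ℝ≥0∞}, ENNReal.ofReal (1 / 2) ^ N * t < ∞ → t < ∞ := by
    intro t ht
    rw [lt_top_iff_ne_top]
    rintro rfl
    rw [ENNReal.mul_top hne] at ht
    exact lt_irrefl _ ht
  obtain ⟨k, hk⟩ := pow_unbounded_of_one_lt (1 / α) hq1
  have hk' : 1 ≤ α * q ^ k := by
    rw [div_lt_iff₀ h0] at hk; linarith
  clear hk
  -- With `lam = 1 / 2` fixed, `α` is multiplied by `q` until `α * q ≥ 1`; then `α ≥ 1 - s`, since
  -- `s * d ≤ s`, and the second inequality ends the iteration.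
  induction k generalizing α with
  | zero => simp at hk'; linarith
  | succ k ih =>
    rcases lt_or_ge (α * q) 1 with h | h
    · refine hlt ((hI α h0 h).trans_lt (ih (by positivity) h ?_))
      rw [pow_succ] at hk'
      linarith
    · refine hlt ((hII α h0 h1 ?_).trans_lt ENNReal.one_lt_top)
      have : s * d ≤ s := mul_le_of_le_one_right hs0.le hd1
      nlinarith

/-- Turns a multiplicative loss `(1 - δ) ^ N` into an additive error linear in `δ`. For `δ > 1 / 2`
the bound `Y ≤ M` is already enough, which costs the extra `2` in the constant. -/
theorem exists_le_add_mul (N : ℕ) : ∃ D : ℝ, 0 ≤ D ∧ ∀ δ X Y M : ℝ, 0 < δ → 0 ≤ X → X ≤ M →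
    Y ≤ M → (δ ≤ 1 / 2 → (1 - δ) ^ N * Y ≤ X) → Y ≤ X + D * M * δ := by
  obtain ⟨D, hD, h⟩ : ∃ D : ℝ, 0 ≤ D ∧ ∀ δ : ℝ, 0 < δ → δ ≤ 1 / 2 →
      1 ≤ (1 - δ) ^ N * (1 + D * δ) := by
    induction N with
    | zero => exact ⟨0, le_rfl, by simp⟩
    | succ N ih =>
      obtain ⟨D, hD, h⟩ := ih
      refine ⟨2 * D + 2, by positivity, fun δ h0 h1 => ?_⟩
      have h2 := h δ h0 h1
      have h3 : 1 ≤ (1 - δ) * (1 + 2 * δ) := by nlinarith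
      have h4 : (1 + D * δ) * (1 + 2 * δ) ≤ 1 + (2 * D + 2) * δ := by
        nlinarith [mul_nonneg hD h0.le]
      have hp : 0 ≤ (1 - δ) ^ (N + 1) := pow_nonneg (by linarith) _
      calc (1 : ℝ) ≤ ((1 - δ) ^ N * (1 + D * δ)) * ((1 - δ) * (1 + 2 * δ)) :=
            one_le_mul_of_one_le_of_one_le h2 h3
        _ = (1 - δ) ^ (N + 1) * ((1 + D * δ) * (1 + 2 * δ)) := by ring
        _ ≤ _ := mul_le_mul_of_nonneg_left h4 hp
  refine ⟨D + 2, by positivity, fun δ X Y M hδ hX hXM hYM hY => ?_⟩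
  have hM : 0 ≤ M := hX.trans hXM
  rcases le_or_gt δ (1 / 2) with hle | hgt
  · have h1 := h δ hδ hle
    have h2 : 0 ≤ 1 + D * δ := by positivity
    rcases le_or_gt Y 0 with hY0 | hY0
    · have : 0 ≤ (D + 2) * M * δ := by positivity
      linarith
    · have : Y ≤ X * (1 + D * δ) := by
        calc Y ≤ ((1 - δ) ^ N * (1 + D * δ)) * Y := le_mul_of_one_le_left hY0.le h1
          _ = ((1 - δ) ^ N * Y) * (1 + D * δ) := by ring
          _ ≤ _ := mul_le_mul_of_nonneg_right (hY hle) h2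
      have h3 : D * δ * X ≤ D * δ * M := mul_le_mul_of_nonneg_left hXM (by positivity)
      nlinarith [mul_nonneg hM hδ.le]
  · have : 0 ≤ D * M * δ := by positivity
    nlinarith

/-- The Tauberian constants of balls are Hölder continuous of exponent `1 / n` on `[a, 1)`, also at
the right end point, where their limit is `1`. -/
theorem exists_tauberianConst_toReal_le (hn : 1 ≤ n) {a : ℝ} (ha0 : 0 < a) (ha1 : a < 1) :
    ∃ A : ℝ, 0 ≤ A ∧
      (∀ α β, a ≤ α → α ≤ β → β < 1 → (tauberianConst (ballBasis n) α).toReal ≤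
        (tauberianConst (ballBasis n) β).toReal + A * (β - α) ^ (1 / n : ℝ)) ∧
      ∀ α, a ≤ α → α < 1 → (tauberianConst (ballBasis n) α).toReal ≤
        1 + A * (1 - α) ^ (1 / n : ℝ) := by
  obtain ⟨c, d, hc, hc1, hd, hd1, N, hN⟩ := exists_tauberianConst_le hn
  obtain ⟨D, hD, hDle⟩ := exists_le_add_mul N
  have hfin : ∀ α, a ≤ α → α < 1 → tauberianConst (ballBasis n) α ≠ ∞ := fun α h h' =>
    (tauberianConst_ballBasis_lt_top hn (ha0.trans_le h) h').ne
  set C : ℝ → ℝ := fun α => (tauberianConst (ballBasis n) α).toReal with hC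
  set M : ℝ := C a with hM
  have hCM : ∀ α, a ≤ α → α < 1 → C α ≤ M := fun α h h' =>
    ENNReal.toReal_mono (hfin a le_rfl ha1) (tauberianConst_antitone _ h)
  have h1M : 1 ≤ M := by
    simpa using ENNReal.toReal_mono (hfin a le_rfl ha1) (one_le_tauberianConst ha1)
  set p : ℝ := 1 / n with hp
  have hp0 : 0 < p := by positivity
  have hroot : ∀ t : ℝ, 0 ≤ t → c * (t ^ p) ^ n = c * t := by
    intro t ht
    rw [hp, one_div, Real.rpow_inv_natCast_pow ht (by omega)]
  set K : ℝ := (1 / (a * c * d)) ^ p with hK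
  have hK0 : 0 ≤ K := by positivity
  refine ⟨D * M * K, by positivity, fun α β haα hαβ hβ => ?_, fun α haα hα => ?_⟩
  · have hα0 : 0 < α := ha0.trans_le haα
    rcases hαβ.eq_or_lt with rfl | hlt
    · have : 0 ≤ D * M * K * (α - α) ^ p := by rw [sub_self]; positivity
      linarith
    -- With `lam = 1 - t ^ p` the improved level `α * (1 + c * (1 - lam) ^ n * d)` is exactly `β`.
    set t : ℝ := (β - α) / (α * c * d) with ht
    have hβα : 0 < β - α := by linarith
    have ht0 : 0 < t := by positivity
    have hαt : α * (1 + c * (1 - (1 - t ^ p)) ^ n * d) = β := by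
      rw [sub_sub_cancel, hroot t ht0.le, ht]
      field_simp
      ring
    have hmain := hDle (t ^ p) (C β) (C α) M (by positivity) ENNReal.toReal_nonneg
      (hCM β (haα.trans hαβ) hβ) (hCM α haα (hαβ.trans_lt hβ)) (fun hle => by
        have h := (hN (1 - t ^ p) (by linarith) (by linarith [Real.rpow_pos_of_pos ht0 p])).1 α hα0
          (by rwa [hαt])
        rw [hαt] at h
        have h' := ENNReal.toReal_mono (hfin β (haα.trans hαβ) hβ) h
        rwa [ENNReal.toReal_mul, ENNReal.toReal_pow, ENNReal.toReal_ofReal (by linarith)] at h')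
    refine hmain.trans ?_
    have : t ^ p ≤ K * (β - α) ^ p := by
      rw [hK, ← Real.mul_rpow (by positivity) hβα.le]
      refine Real.rpow_le_rpow ht0.le ?_ hp0.le
      rw [ht, div_eq_mul_one_div, mul_comm]
      gcongr
    have h2 : D * M * t ^ p ≤ D * M * (K * (β - α) ^ p) := by gcongr
    linarith
  · have hα0 : 0 < α := ha0.trans_le haα
    -- Here `lam = 1 - t ^ p` makes the threshold `1 - c * (1 - lam) ^ n` equal to `α`.
    set t : ℝ := (1 - α) / c with ht
    have h1α : 0 < 1 - α := by linarith
    have ht0 : 0 < t := by positivity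
    have hmain := hDle (t ^ p) 1 (C α) M (by positivity) zero_le_one h1M (hCM α haα hα)
      (fun hle => by
        have h := (hN (1 - t ^ p) (by linarith) (by linarith [Real.rpow_pos_of_pos ht0 p])).2 α hα0
          hα (by rw [sub_sub_cancel, hroot t ht0.le, ht, mul_div_cancel₀ _ hc.ne']; linarith)
        have h' := ENNReal.toReal_mono ENNReal.one_ne_top h
        rwa [ENNReal.toReal_mul, ENNReal.toReal_pow, ENNReal.toReal_ofReal (by linarith),
          ENNReal.toReal_one] at h')
    refine hmain.trans ?_
    have : t ^ p ≤ K * (1 - α) ^ p := by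
      rw [hK, ← Real.mul_rpow (by positivity) h1α.le]
      refine Real.rpow_le_rpow ht0.le ?_ hp0.le
      rw [ht, div_eq_mul_one_div, mul_comm]
      refine mul_le_mul_of_nonneg_right (one_div_le_one_div_of_le (by positivity) ?_) h1α.le
      have : a * d ≤ 1 := mul_le_one₀ ha1.le hd.le hd1
      nlinarith
    have h2 : D * M * t ^ p ≤ D * M * (K * (1 - α) ^ p) := by gcongr
    linarith

end Tauberian

/-! ### Hölder classes and the halo function. -/

section Holder

theorem holderOnWith_of_abs_sub_le {f : ℝ → ℝ} {K : Set ℝ} {A : ℝ} {p : ℝ≥0} (hA : 0 ≤ A)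
    (h : ∀ x ∈ K, ∀ y ∈ K, x ≤ y → |f x - f y| ≤ A * (y - x) ^ (p : ℝ)) :
    HolderOnWith A.toNNReal p f K := by
  intro x hx y hy
  have key : |f x - f y| ≤ A * |x - y| ^ (p : ℝ) := by
    rcases le_total x y with hxy | hxy
    · rw [abs_sub_comm x, abs_of_nonneg (sub_nonneg.2 hxy)]
      exact h x hx y hy hxy
    · rw [abs_sub_comm, abs_of_nonneg (sub_nonneg.2 hxy)]
      exact h y hy x hx hxy
  rw [edist_dist, edist_dist, Real.dist_eq, Real.dist_eq,
    ENNReal.ofReal_rpow_of_nonneg (abs_nonneg _) p.coe_nonneg]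
  refine (ENNReal.ofReal_le_ofReal key).trans (le_of_eq ?_)
  rw [ENNReal.ofReal_mul hA]
  rfl

theorem LocHolderClass.mono {p : ℝ≥0} {I J : Set ℝ} {f : ℝ → ℝ} (h : LocHolderClass p I f)
    (hJ : J ⊆ I) : LocHolderClass p J f :=
  fun K hK hc => h K (hK.trans hJ) hc

theorem LocHolderClass.of_le {p q : ℝ≥0} {I : Set ℝ} {f : ℝ → ℝ} (h : LocHolderClass p I f)
    (hq : q ≤ p) : LocHolderClass q I f := by
  intro K hK hc
  obtain ⟨A, hA⟩ := h K hK hc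
  obtain ⟨D, hD⟩ := Metric.isBounded_iff_nndist.1 hc.isBounded
  exact ⟨_, hA.of_le (D := D) (fun x hx y hy => by
    rw [edist_nndist]; exact_mod_cast hD hx hy) hq⟩

variable {n : ℕ}

theorem locHolderClass_tauberianConst (hn : 1 ≤ n) :
    LocHolderClass (1 / (n : ℝ≥0)) (Ioo (0 : ℝ) 1)
      (fun α => (tauberianConst (ballBasis n) α).toReal) := by
  intro K hK hc
  rcases K.eq_empty_or_nonempty with rfl | hne
  · exact ⟨0, holderOnWith_empty _ _ _⟩
  obtain ⟨a, haK, ha⟩ := hc.exists_isLeast hne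
  obtain ⟨A, hA0, hA, -⟩ := exists_tauberianConst_toReal_le hn (hK haK).1 (hK haK).2
  refine ⟨A.toNNReal, holderOnWith_of_abs_sub_le hA0 fun x hx y hy hxy => ?_⟩
  have h1 := hA x y (ha hx) hxy (hK hy).2
  have h2 : (tauberianConst (ballBasis n) y).toReal ≤ (tauberianConst (ballBasis n) x).toReal :=
    ENNReal.toReal_mono (tauberianConst_ballBasis_lt_top hn (hK hx).1 (hK hx).2).ne
      (tauberianConst_antitone _ hxy)
  rw [abs_of_nonneg (sub_nonneg.2 h2)]
  push_cast
  linarith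

theorem haloFun_ballBasis_lt_top (hn : 1 ≤ n) (x : ℝ) : haloFun (ballBasis n) x < ∞ := by
  unfold haloFun
  split_ifs with h
  · exact ENNReal.ofReal_lt_top
  · have hx : 1 < x := not_le.1 h
    exact tauberianConst_ballBasis_lt_top hn (by positivity) ((div_lt_one (by positivity)).2 hx)

/-- Exponent `1 / n` survives across `x = 1`: the bound of the Tauberian constant near `α = 1` glues
the two branches, and `x ↦ 1 / x` is Lipschitz on `[1, ∞)`. -/
theorem locHolderClass_haloFun (hn : 1 ≤ n) :
    LocHolderClass (1 / (n : ℝ≥0)) (Ici (0 : ℝ)) (fun x => (haloFun (ballBasis n) x).toReal) := by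
  intro K hK hc
  obtain ⟨b, hb⟩ := hc.bddAbove
  -- The `2` guarantees `1 / R < 1` even when `K` lies in `[0, 1]`.
  set R : ℝ := max b 2 with hR
  have hR2 : 2 ≤ R := le_max_right _ _
  have hKR : ∀ x ∈ K, x ≤ R := fun x hx => (hb hx).trans (le_max_left _ _)
  have hn' : (1 : ℝ) ≤ n := by exact_mod_cast hn
  obtain ⟨A, hA0, hA, hA1⟩ := exists_tauberianConst_toReal_le hn (a := 1 / R) (by positivity)
    ((div_lt_one (by positivity)).2 (by linarith))
  set p : ℝ := 1 / n with hp
  have hp0 : 0 ≤ p := by positivity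
  have hp1 : p ≤ 1 := (div_le_one (by positivity)).2 hn'
  have hself : ∀ t : ℝ, 0 ≤ t → t ≤ 1 → t ≤ t ^ p := fun t h0 h1 =>
    Real.self_le_rpow_of_le_one h0 h1 hp1
  have hinv : ∀ x : ℝ, 1 < x → 1 / x < 1 := fun x hx => (div_lt_one (by linarith)).2 hx
  have hlow : ∀ x ∈ K, 1 < x → 1 / R ≤ 1 / x := fun x hx h1 =>
    one_div_le_one_div_of_le (by linarith) (hKR x hx)
  have hfun1 : ∀ x : ℝ, 0 ≤ x → x ≤ 1 → (haloFun (ballBasis n) x).toReal = x := by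
    intro x h0 h1
    rw [haloFun, if_pos h1, ENNReal.toReal_ofReal h0]
  have hfun2 : ∀ x : ℝ, 1 < x → (haloFun (ballBasis n) x).toReal =
      (tauberianConst (ballBasis n) (1 / x)).toReal := by
    intro x h1
    rw [haloFun, if_neg (not_le.2 h1)]
  refine ⟨(A + 1).toNNReal, holderOnWith_of_abs_sub_le (by positivity) fun x hx y hy hxy => ?_⟩
  have hcast : ((1 / (n : ℝ≥0) : ℝ≥0) : ℝ) = p := by push_cast; rfl
  rw [hcast]
  have hx0 : 0 ≤ x := hK hx
  have hyx : 0 ≤ y - x := sub_nonneg.2 hxy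
  have hpow0 : 0 ≤ (y - x) ^ p := Real.rpow_nonneg hyx p
  rcases le_or_gt y 1 with hy1 | hy1
  · rw [hfun1 x hx0 (hxy.trans hy1), hfun1 y (hx0.trans hxy) hy1, abs_sub_comm, abs_of_nonneg hyx]
    have := hself (y - x) hyx (by linarith)
    nlinarith [mul_nonneg hA0 hpow0]
  · have hC1 : 1 ≤ (tauberianConst (ballBasis n) (1 / y)).toReal := by
      simpa using ENNReal.toReal_mono
        (tauberianConst_ballBasis_lt_top hn (by positivity) (hinv y hy1)).ne
        (one_le_tauberianConst (hinv y hy1))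
    rcases le_or_gt x 1 with hx1 | hx1
    -- Across the joint the increment splits at the value 1: `C(1 / y) - 1` is controlled through `1
    -- - 1 / y ≤ y - 1`, and `1 - x` by its own power, both at most `(y - x) ^ p` up to constants.
    · rw [hfun1 x hx0 hx1, hfun2 y hy1, abs_sub_comm, abs_of_nonneg (by linarith)]
      have h1 := hA1 (1 / y) (hlow y hy hy1) (hinv y hy1)
      have h2 : (1 - 1 / y) ^ p ≤ (y - x) ^ p := by
        refine Real.rpow_le_rpow (by linarith [hinv y hy1]) ?_ hp0
        have : 1 - 1 / y ≤ y - 1 := by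
          have := hinv y hy1
          have h3 : 1 / y * y = 1 := by field_simp
          nlinarith
        linarith
      have h3 : 1 - x ≤ (y - x) ^ p := by
        refine (hself (1 - x) (by linarith) (by linarith)).trans ?_
        exact Real.rpow_le_rpow (by linarith) (by linarith) hp0
      nlinarith [mul_le_mul_of_nonneg_left h2 hA0]
    · rw [hfun2 x hx1, hfun2 y hy1]
      have hle : 1 / y ≤ 1 / x := one_div_le_one_div_of_le (by linarith) hxy
      have h1 := hA (1 / y) (1 / x) (hlow y hy hy1) hle (hinv x hx1)
      have hmono : (tauberianConst (ballBasis n) (1 / x)).toReal ≤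
          (tauberianConst (ballBasis n) (1 / y)).toReal :=
        ENNReal.toReal_mono (tauberianConst_ballBasis_lt_top hn (by positivity) (hinv y hy1)).ne
          (tauberianConst_antitone _ hle)
      rw [abs_sub_comm, abs_of_nonneg (sub_nonneg.2 hmono)]
      have h2 : (1 / x - 1 / y) ^ p ≤ (y - x) ^ p := by
        refine Real.rpow_le_rpow (sub_nonneg.2 hle) ?_ hp0
        have e : 1 / x - 1 / y = (y - x) / (x * y) := by field_simp
        rw [e]
        exact div_le_self hyx (by nlinarith)
      nlinarith [mul_le_mul_of_nonneg_left h2 hA0]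

end Holder

theorem theoremt (n : ℕ) (hn : 1 ≤ n) :
    ((∀ x ∈ Ici (0 : ℝ), haloFun (ballBasis n) x < ∞) ∧
      LocHolderClass (1 / ((n : ℝ≥0) + 1)) (Ici (0 : ℝ))
        (fun x => (haloFun (ballBasis n) x).toReal)) ∧
    ((∀ α ∈ Ioo (0 : ℝ) 1, tauberianConst (ballBasis n) α < ∞) ∧
      LocHolderClass (1 / (n : ℝ≥0)) (Ioo (0 : ℝ) 1)
        (fun α => (tauberianConst (ballBasis n) α).toReal)) ∧
    LocHolderClass (1 / (n : ℝ≥0)) (Ioi (1 : ℝ))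
      (fun x => (haloFun (ballBasis n) x).toReal) := by
  have hn0 : (0 : ℝ≥0) < n := by exact_mod_cast hn
  refine ⟨⟨fun x _ => haloFun_ballBasis_lt_top hn x, (locHolderClass_haloFun hn).of_le ?_⟩,
    ⟨fun α hα => tauberianConst_ballBasis_lt_top hn hα.1 hα.2, locHolderClass_tauberianConst hn⟩,
    (locHolderClass_haloFun hn).mono fun x hx => ?_⟩
  · exact one_div_le_one_div_of_le hn0 le_self_add
  · exact (zero_lt_one.trans (mem_Ioi.1 hx)).le
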